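/- Setting. A bin packing instance is a vector $s\in[0,1]^m$ of item sizes. A packing assigns every item to a bin so that the sizes in each bin sum to at most $1$. $OPT_f(s)$ is the value of the Gilmore–Gomory relaxation $\min\{\mathbf 1^Tx : Ax=\mathbf 1,\ x\ge \mathbf 0\}$ (an infimum, over finitely supported $x$), where the columns of $A$ are all patterns $p\in\mathbb Z_{\ge0}^m$ with $p^Ts\le 1$. Algorithms are programs of a fixed deterministic list-processing machine with exact arithmetic ($+,-,\cdot,/$ and comparisons) on numbers, and "polynomial time" is taken in either of two models: (a) real sizes, every step has unit cost, time at most $q(m)$ for some polynomial $q$; (b) rational sizes, arithmetic steps are charged additionally the bit lengths of the numbers involved, time at most $q(L)$ for some polynomial $q$, where $L$ is the binary encoding length of $s$. Lemma. There is an absolute constant $C$ such that the following holds in each of the models (a) and (b), for every monotone (nondecreasing) function $f:[0,\infty)\to\mathbb R$. Suppose that there is a polynomial-time algorithm which, for every $m,n\in\mathbb Z_{\ge0}$ and every instance $s\in[0,1]^m$ with $|\{s_i : i\in[m]\}|\le n$ and $\min_i s_i\ge \frac1n$ (for $n=0$ this means the empty instance), finds a packing of $s$ into at most $OPT_f(s)+f(n)$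 bins. Then there is a polynomial-time algorithm which, for every $m$ and every instance $s\in[0,1]^m$, finds a packing of $s$ into at most $$OPT_f(s)+f(OPT_f(s))+C\log\big(OPT_f(s)+2\big)$$ bins. -/

import Mathlib

namespace BinPacking

/-! ### Instances, packings and the Gilmore-Gomory relaxation -/

/-- A (valid) pattern for the sizes `s`: a multiset of items of total size at most `1`. -/
def IsPattern {m : ℕ} (s : Fin m → ℝ) (p : Fin m → ℕ) : Prop :=
  ∑ i, (p i : ℝ) * s i ≤ 1

/-- The objective values `1ᵀ x` of the feasible solutions `x` of the Gilmore-Gomory relaxation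
`A x = 1`, `x ≥ 0`, whose columns are all the patterns of `s`. (If some item has size `0` there
are infinitely many patterns; `x` has finite support.) -/
def fractionalValues {m : ℕ} (s : Fin m → ℝ) : Set ℝ :=
  {v | ∃ x : (Fin m → ℕ) →₀ ℝ,
    (∀ p, 0 ≤ x p) ∧ (∀ p ∈ x.support, IsPattern s p) ∧
    (∀ i, ∑ p ∈ x.support, x p * (p i : ℝ) = 1) ∧ v = ∑ p ∈ x.support, x p}

/-- `OPT_f`, the value of the Gilmore-Gomory relaxation. -/
noncomputable def optF {m : ℕ} (s : Fin m → ℝ) : ℝ :=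
  sInf (fractionalValues s)

/-- `a i` is the label of the bin that receives item `i`; every bin has load at most `1`. -/
def IsPacking {K : Type*} [Field K] [LinearOrder K] {m : ℕ} (s : Fin m → K) (a : Fin m → ℕ) :
    Prop :=
  ∀ b, ∑ i with a i = b, s i ≤ 1

/-- The number of bins that are used by an assignment. -/
def numBins {m : ℕ} (a : Fin m → ℕ) : ℕ :=
  (Finset.univ.image a).card

/-- The number of different item sizes. -/
def numSizes {K : Type*} [LinearOrder K] {m : ℕ} (s : Fin m → K) : ℕ :=
  (Finset.univ.image s).card

/-! ### The machine model

Programs work on binary trees whose atoms are `nil` and numbers from an ordered field `K`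
(a list-processing machine: a `WHILE` language on trees, extended with exact arithmetic).
Trees are shared, never copied, so that every step on trees costs one unit. -/

/-- The data of a program. -/
inductive Datum (K : Type*) where
  | nil : Datum K
  | num : K → Datum K
  | cons : Datum K → Datum K → Datum K

namespace Datum

variable {K : Type*}

def head : Datum K → Datum K
  | cons a _ => a
  | _ => nil

def tail : Datum K → Datum K
  | cons _ b => b
  | _ => nil

/-- The number at a leaf; `0` for data that are not numbers. -/
def val [Zero K] : Datum K → K
  | num x => x
  | _ => 0

/-- The list `v 0, v 1, …, v (m - 1)` of numbers as a datum. -/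
def encode {m : ℕ} (v : Fin m → K) : Datum K :=
  (List.ofFn v).foldr (fun x d => cons (num x) d) nil

end Datum

/-- The arithmetic operations; division by `0` yields `0`. -/
inductive ArithOp where
  | add
  | sub
  | mul
  | div

/-- The result of an arithmetic operation. -/
def ArithOp.apply {K : Type*} [Field K] : ArithOp → K → K → K
  | add, x, y => x + y
  | sub, x, y => x - y
  | mul, x, y => x * y
  | div, x, y => x / y

/-- Programs; each denotes a partial function from data to data. The only numerical constant
is `1`, so a program is a finite object that does not depend on the field. -/
inductive Prog where
  /-- return the input -/
  | id
  /-- return `nil` -/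
  | nil
  /-- return the number `1` -/
  | one
  /-- the first component of the input -/
  | head
  /-- the second component of the input -/
  | tail
  /-- an arithmetic operation on the two components of the input -/
  | arith (o : ArithOp)
  /-- compare the two components of the input: `cons nil nil` for "at most", else `nil` -/
  | le
  /-- run both programs on the input and return the pair of the results -/
  | pair (P Q : Prog)
  /-- run `P`, then run `Q` on its result -/
  | seq (P Q : Prog)
  /-- run `P` if the test `c` does not return `nil` on the input, and `Q` if it does -/
  | ite (c P Q : Prog)
  /-- as long as the test `c` does not return `nil` on the current datum, replace this datum
  by the result of `P` on it -/
  | loop (c P : Prog)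

/-- `Eval size P d e t`: started on `d`, the program `P` halts with result `e` after time `t`.
Each elementary step costs `1`; an arithmetic operation or a comparison costs in addition the
sizes of the numbers involved, measured by `size`. -/
inductive Eval {K : Type*} [Field K] [LinearOrder K] (size : K → ℕ) :
    Prog → Datum K → Datum K → ℕ → Prop
  | id (d : Datum K) : Eval size .id d d 1
  | nil (d : Datum K) : Eval size .nil d .nil 1
  | one (d : Datum K) : Eval size .one d (.num 1) 1
  | head (d : Datum K) : Eval size .head d d.head 1
  | tail (d : Datum K) : Eval size .tail d d.tail 1
  | arith (o : ArithOp) (d : Datum K) :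
      Eval size (.arith o) d (.num (o.apply d.head.val d.tail.val))
        (1 + size d.head.val + size d.tail.val + size (o.apply d.head.val d.tail.val))
  | le (d : Datum K) :
      Eval size .le d (if d.head.val ≤ d.tail.val then .cons .nil .nil else .nil)
        (1 + size d.head.val + size d.tail.val)
  | pair {P Q : Prog} {d a b : Datum K} {t u : ℕ} :
      Eval size P d a t → Eval size Q d b u → Eval size (.pair P Q) d (.cons a b) (t + u + 1)
  | seq {P Q : Prog} {d a b : Datum K} {t u : ℕ} :
      Eval size P d a t → Eval size Q a b u → Eval size (.seq P Q) d b (t + u + 1)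
  | ite_true {c P Q : Prog} {d b e : Datum K} {t u : ℕ} :
      Eval size c d b t → b ≠ .nil → Eval size P d e u → Eval size (.ite c P Q) d e (t + u + 1)
  | ite_false {c P Q : Prog} {d e : Datum K} {t u : ℕ} :
      Eval size c d .nil t → Eval size Q d e u → Eval size (.ite c P Q) d e (t + u + 1)
  | loop_stop {c P : Prog} {d : Datum K} {t : ℕ} :
      Eval size c d .nil t → Eval size (.loop c P) d d (t + 1)
  | loop_step {c P : Prog} {d b d' e : Datum K} {t u v : ℕ} :
      Eval size c d b t → b ≠ .nil → Eval size P d d' u → Eval size (.loop c P) d' e v →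
      Eval size (.loop c P) d e (t + u + v + 1)

/-- Unit cost on real numbers (real RAM): the time is the number of steps. -/
def unitCost : ℝ → ℕ := fun _ => 0

/-- Bit cost on rational numbers: the number of binary digits of numerator and denominator. -/
def bitCost (q : ℚ) : ℕ := q.num.natAbs.size + q.den.size

/-- The binary encoding length of a rational instance. -/
def encodingLength {m : ℕ} (s : Fin m → ℚ) : ℕ := ∑ i, (bitCost (s i) + 1)

/-- On the instance `s`, given as the list of its sizes, the program `P` halts within time `T`
and outputs (as the list of the bin labels of the items) a packing with at most `β` bins. -/
def PacksWithin {K : Type*} [Field K] [LinearOrder K] (size : K → ℕ) (P : Prog) {m : ℕ}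
    (s : Fin m → K) (T : ℕ) (β : ℝ) : Prop :=
  ∃ a : Fin m → ℕ,
    (∃ t ≤ T, Eval size P (Datum.encode s) (Datum.encode fun i => (a i : K)) t) ∧
    IsPacking s a ∧ (numBins a : ℝ) ≤ β

end BinPacking

namespace BinPacking

/-! ### Polynomial-time functions on encoded data -/

/-! Let `σ` be the total size and `n = ⌊σ⌋`, so `n ≤ σ ≤ optF s`. Items of size below `1/n` are set
aside. The large ones are sorted by decreasing size and cut into consecutive groups, each closed as
soon as its total reaches `1`; a group thus has total at most `2`, and at most `σ` groups are
closed. Sizes are rounded up to the largest of their group, and an item is kept only if some earlier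
group also has an item at its position.

A kept item can be matched injectively with an item of an earlier group, whose size is at least the
rounded size; hence rounding does not raise the relaxation above `optF s` (`optF_le_of_injective`).
No item of the first group is kept, so at most `n` rounded sizes occur. An item discarded at
position `i` is the smallest of `i + 1` items of total at most `2`, and each position is discarded
at most once, so the discarded total is at most twice the harmonic number of `2n`, which is `O(log
n)`. This is `group_spec`; its content is the invariant `GroupInv`.

The given algorithm packs the rounded kept items into `optF s + f n` bins at most, and `f n ≤ f
(optF s)`. Any-fit adds the discarded items at a cost of `O(log n)` bins. Then it adds the small
ones: either they open no bin, or all bins but one have load at least `1 - 1/n` on average and the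
volume bound gives `σ + 4` bins (`complete_spec`).

For the running time, everything around the given algorithm is built from polynomial folds that only
add, subtract and compare (`PolyTime`). Sums do not enlarge a common denominator and gain at most
one bit per step, so the same programs are polynomial under bit cost (`Eval.bitCost_of_unit`). The
correctness argument works over any ordered field `K` and serves both models. -/

theorem polynomial_eval_mono (p : Polynomial ℕ) : Monotone fun n => p.eval n := by
  intro a b hab
  simp only [Polynomial.eval_eq_sum, Polynomial.sum]
  gcongr

/-- The number of nodes of a datum, as a tree. -/
def Datum.nodes {K : Type*} : Datum K → ℕ
  | .nil => 1
  | .num _ => 1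
  | .cons a b => a.nodes + b.nodes + 1

/-- Encodings of typed values as data over `K`. -/
class Enc (K : Type*) (α : Type*) where
  enc : α → Datum K

section Encodings

variable {K α β : Type*}

instance : Enc K K := ⟨.num⟩
instance : Enc K Unit := ⟨fun _ => .nil⟩
instance [Enc K α] [Enc K β] : Enc K (α × β) := ⟨fun x => .cons (Enc.enc x.1) (Enc.enc x.2)⟩
instance [Enc K α] : Enc K (List α) :=
  ⟨fun l => l.foldr (fun x d => .cons (Enc.enc x) d) .nil⟩

/-- The number of nodes of the encoding of `x`. -/
def esize (K : Type*) {α : Type*} [Enc K α] (x : α) : ℕ := (Enc.enc (K := K) x).nodes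

@[simp] theorem enc_self (x : K) : Enc.enc (K := K) x = .num x := rfl
@[simp] theorem enc_unit (x : Unit) : Enc.enc (K := K) x = .nil := rfl
@[simp] theorem enc_prod [Enc K α] [Enc K β] (x : α × β) :
    Enc.enc (K := K) x = .cons (Enc.enc x.1) (Enc.enc x.2) := rfl
@[simp] theorem enc_list_nil [Enc K α] : Enc.enc (K := K) ([] : List α) = .nil := rfl
@[simp] theorem enc_list_cons [Enc K α] (x : α) (l : List α) :
    Enc.enc (K := K) (x :: l) = .cons (Enc.enc x) (Enc.enc l) := rfl

@[simp] theorem esize_self (x : K) : esize K x = 1 := rfl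
@[simp] theorem esize_unit (x : Unit) : esize K x = 1 := rfl
@[simp] theorem esize_prod [Enc K α] [Enc K β] (x : α × β) :
    esize K x = esize K x.1 + esize K x.2 + 1 := rfl
@[simp] theorem esize_list_nil [Enc K α] : esize K ([] : List α) = 1 := rfl
@[simp] theorem esize_list_cons [Enc K α] (x : α) (l : List α) :
    esize K (x :: l) = esize K x + esize K l + 1 := rfl

theorem esize_list [Enc K α] (l : List α) :
    esize K l = (l.map fun x => esize K x + 1).sum + 1 := by
  induction l with
  | nil => rfl
  | cons x l ih => simp [ih]; omega

theorem length_le_esize [Enc K α] (l : List α) : l.length ≤ esize K l := by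
  induction l with
  | nil => simp
  | cons x l ih => simp; omega

theorem esize_le_of_mem [Enc K α] {l : List α} {x : α} (h : x ∈ l) : esize K x ≤ esize K l := by
  induction l with
  | nil => simp at h
  | cons y l ih =>
    rcases List.mem_cons.1 h with rfl | h
    · simp; omega
    · have := ih h; simp; omega

theorem esize_perm [Enc K α] {l l' : List α} (h : l.Perm l') : esize K l = esize K l' := by
  rw [esize_list, esize_list, (h.map _).sum_eq]

theorem encode_eq_enc {m : ℕ} (v : Fin m → K) : Datum.encode v = Enc.enc (List.ofFn v) := rfl

theorem esize_list_self (l : List K) : esize K l = 2 * l.length + 1 := by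
  induction l with
  | nil => rfl
  | cons x l ih => simp [ih]; omega

end Encodings

/-- The only arithmetic operations of the program are additions and subtractions. -/
def Prog.Additive : Prog → Prop
  | .arith o => o = .add ∨ o = .sub
  | .pair P Q => P.Additive ∧ Q.Additive
  | .seq P Q => P.Additive ∧ Q.Additive
  | .ite c P Q => c.Additive ∧ P.Additive ∧ Q.Additive
  | .loop c P => c.Additive ∧ P.Additive
  | _ => True

/-- `f` is computed by an additive program; the number of steps and the size of the result are
polynomial in the size of the argument. -/
def PolyTime (K : Type*) [Field K] [LinearOrder K] {α β : Type*} [Enc K α] [Enc K β]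
    (f : α → β) : Prop :=
  ∃ (P : Prog) (p : Polynomial ℕ), P.Additive ∧ ∀ x,
    (∃ t ≤ p.eval (esize K x), Eval (fun _ : K => 0) P (Enc.enc x) (Enc.enc (f x)) t) ∧
      esize K (f x) ≤ p.eval (esize K x)

namespace PolyTime

variable {K : Type*} [Field K] [LinearOrder K] {α β γ σ : Type*}
  [Enc K α] [Enc K β] [Enc K γ] [Enc K σ]

theorem id : PolyTime K (fun x : α => x) :=
  ⟨.id, .X + 1, trivial, fun x => ⟨⟨1, by simp, .id _⟩, by simp⟩⟩

theorem comp {g : β → γ} {f : α → β} (hg : PolyTime K g) (hf : PolyTime K f) :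
    PolyTime K (fun x => g (f x)) := by
  obtain ⟨P, p, hP, h⟩ := hf
  obtain ⟨Q, q, hQ, k⟩ := hg
  refine ⟨.seq P Q, p + q.comp p + 1, ⟨hP, hQ⟩, fun x => ?_⟩
  obtain ⟨⟨t, ht, et⟩, hs⟩ := h x
  obtain ⟨⟨u, hu, eu⟩, hs'⟩ := k (f x)
  have := polynomial_eval_mono q hs
  simp only [Polynomial.eval_add, Polynomial.eval_comp, Polynomial.eval_one] at this ⊢
  exact ⟨⟨_, by omega, .seq et eu⟩, by omega⟩

theorem prodMk {f : α → β} {g : α → γ} (hf : PolyTime K f) (hg : PolyTime K g) :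
    PolyTime K (fun x => (f x, g x)) := by
  obtain ⟨P, p, hP, h⟩ := hf
  obtain ⟨Q, q, hQ, k⟩ := hg
  refine ⟨.pair P Q, p + q + 1, ⟨hP, hQ⟩, fun x => ?_⟩
  obtain ⟨⟨t, ht, et⟩, hs⟩ := h x
  obtain ⟨⟨u, hu, eu⟩, hs'⟩ := k x
  simp only [Polynomial.eval_add, Polynomial.eval_one, esize_prod]
  exact ⟨⟨_, by omega, .pair et eu⟩, by omega⟩

theorem cons {f : α → β} {g : α → List β} (hf : PolyTime K f) (hg : PolyTime K g) :
    PolyTime K (fun x => f x :: g x) :=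
  prodMk hf hg

theorem fst {f : α → β × γ} (hf : PolyTime K f) : PolyTime K (fun x => (f x).1) :=
  comp (g := Prod.fst)
    ⟨.head, .X + 1, trivial, fun x => ⟨⟨1, by simp, .head _⟩, by simp; omega⟩⟩ hf

theorem snd {f : α → β × γ} (hf : PolyTime K f) : PolyTime K (fun x => (f x).2) :=
  comp (g := Prod.snd)
    ⟨.tail, .X + 1, trivial, fun x => ⟨⟨1, by simp, .tail _⟩, by simp; omega⟩⟩ hf

theorem tail {f : α → List β} (hf : PolyTime K f) : PolyTime K (fun x => (f x).tail) :=
  comp (g := List.tail)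
    ⟨.tail, .X + 1, trivial, fun x => ⟨⟨1, by simp, by cases x <;> exact .tail _⟩, by
      cases x <;> simp; omega⟩⟩ hf

theorem nil : PolyTime K (fun _ : α => ([] : List β)) :=
  ⟨.nil, 1, trivial, fun x => ⟨⟨1, by simp, .nil _⟩, by simp⟩⟩

theorem unit : PolyTime K (fun _ : α => ()) :=
  ⟨.nil, 1, trivial, fun x => ⟨⟨1, by simp, .nil _⟩, by simp⟩⟩

theorem one : PolyTime K (fun _ : α => (1 : K)) :=
  ⟨.one, 1, trivial, fun x => ⟨⟨1, by simp, .one _⟩, by simp⟩⟩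

theorem add {f g : α → K} (hf : PolyTime K f) (hg : PolyTime K g) :
    PolyTime K (fun x => f x + g x) :=
  comp (g := fun y : K × K => y.1 + y.2)
    ⟨.arith .add, 1, .inl rfl, fun x => ⟨⟨1, by simp, .arith _ _⟩, by simp⟩⟩ (prodMk hf hg)

theorem sub {f g : α → K} (hf : PolyTime K f) (hg : PolyTime K g) :
    PolyTime K (fun x => f x - g x) :=
  comp (g := fun y : K × K => y.1 - y.2)
    ⟨.arith .sub, 1, .inr rfl, fun x => ⟨⟨1, by simp, .arith _ _⟩, by simp⟩⟩ (prodMk hf hg)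

theorem zero : PolyTime K (fun _ : α => (0 : K)) := by
  simpa using sub (α := α) (K := K) one one

theorem headD {f : α → List K} (hf : PolyTime K f) : PolyTime K (fun x => (f x).headD 0) := by
  -- `.head` alone returns `nil` on an empty list; adding the value `0` of `nil` turns this into the
  -- number `0` and leaves a genuine head unchanged.
  refine comp (g := fun l : List K => l.headD 0)
    ⟨.seq (.pair .head .nil) (.arith .add), 5, ⟨⟨trivial, trivial⟩, .inl rfl⟩,
      fun x => ⟨⟨5, by simp, ?_⟩, by simp⟩⟩ hf
  have h := Eval.seq (size := fun _ : K => 0) (.pair (.head (Enc.enc x)) (.nil _)) (.arith .add _)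
  convert h using 2
  cases x <;> simp [Datum.head, Datum.tail, Datum.val, ArithOp.apply]

theorem ite_le {a b : α → K} {f g : α → β} (ha : PolyTime K a) (hb : PolyTime K b)
    (hf : PolyTime K f) (hg : PolyTime K g) :
    PolyTime K (fun x => if a x ≤ b x then f x else g x) := by
  obtain ⟨R, r, hR, j⟩ := prodMk ha hb
  obtain ⟨P, p, hP, h⟩ := hf
  obtain ⟨Q, q, hQ, k⟩ := hg
  refine ⟨.ite (.seq R .le) P Q, r + p + q + 3, ⟨⟨hR, trivial⟩, hP, hQ⟩, fun x => ?_⟩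
  obtain ⟨⟨v, hv, ev⟩, hs''⟩ := j x
  obtain ⟨⟨t, ht, et⟩, hs⟩ := h x
  obtain ⟨⟨u, hu, eu⟩, hs'⟩ := k x
  have hc := Eval.seq ev (.le _)
  simp only [Polynomial.eval_add, Polynomial.eval_ofNat]
  by_cases hab : a x ≤ b x
  · rw [if_pos (by simpa [Datum.head, Datum.tail, Datum.val] using hab)] at hc
    simp only [hab, if_true]
    exact ⟨⟨_, by omega, .ite_true hc (by simp) et⟩, by omega⟩
  · rw [if_neg (by simpa [Datum.head, Datum.tail, Datum.val] using hab)] at hc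
    simp only [hab, if_false]
    exact ⟨⟨_, by omega, .ite_false hc eu⟩, by omega⟩

/-- The loop runs on the triple of remaining list, parameter and state; the test `.head` returns the
remaining list, which is `nil` exactly at the end. Growth in `hc` is additive, so a bound `S` for
all intermediate states can be reserved beforehand; a growth factor per step would permit
exponential size. -/
theorem loop_foldl {step : α → σ → β → σ} {P : Prog} {p : Polynomial ℕ} (c : ℕ)
    (hP : ∀ x : α × σ × β, ∃ t ≤ p.eval (esize K x),
      Eval (fun _ : K => 0) P (Enc.enc x) (Enc.enc (step x.1 x.2.1 x.2.2)) t)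
    (hc : ∀ a st b, esize K (step a st b) ≤ esize K st + c * (esize K a + esize K b + 1))
    (a : α) (S B : ℕ) (l : List β) (hl : ∀ b ∈ l, esize K b ≤ B) :
    ∀ st : σ, esize K st + l.length * (c * (esize K a + B + 1)) ≤ S →
    (∃ t ≤ l.length * (p.eval (esize K a + S + B + 2) + 30) + 2,
      Eval (fun _ : K => 0) (.loop .head (.pair (.seq .head .tail) (.pair (.seq .tail .head)
        (.seq (.pair (.seq .tail .head) (.pair (.seq .tail .tail) (.seq .head .head))) P))))
        (Enc.enc (l, a, st)) (Enc.enc (([] : List β), a, l.foldl (step a) st)) t) ∧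
      esize K (l.foldl (step a) st) ≤ S := by
  induction l with
  | nil =>
    intro st hS
    exact ⟨⟨2, by simp, Eval.loop_stop (.head _)⟩, by simpa using hS⟩
  | cons b l ih =>
    intro st hS
    have hb : esize K b ≤ B := hl b (by simp)
    have h1 := hc a st b
    have h2 : c * (esize K a + esize K b + 1) ≤ c * (esize K a + B + 1) := by gcongr
    rw [List.length_cons, Nat.succ_mul] at hS
    obtain ⟨⟨t, ht, et⟩, hs⟩ := ih (fun b' h' => hl b' (by simp [h'])) (step a st b) (by omega)
    obtain ⟨u, hu, eu⟩ := hP (a, st, b)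
    refine ⟨?_, by simpa using hs⟩
    have h3 : p.eval (esize K (a, st, b)) ≤ p.eval (esize K a + S + B + 2) := by
      apply polynomial_eval_mono p
      simp only [esize_prod]
      omega
    rw [List.length_cons, Nat.succ_mul]
    refine ⟨_, ?_, .loop_step (b := Enc.enc (b :: l)) (.head _) (by simp)
      (.pair (.seq (.head _) (.tail _)) (.pair (.seq (.tail _) (.head _))
        (.seq (.pair (.seq (.tail _) (.head _)) (.pair (.seq (.tail _) (.tail _))
          (.seq (.head _) (.head _)))) eu))) et⟩
    omega

theorem foldl {l : α → List β} {init : α → σ} {step : α → σ → β → σ} (hl : PolyTime K l)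
    (hi : PolyTime K init) (hs : PolyTime K (fun x : α × σ × β => step x.1 x.2.1 x.2.2)) (c : ℕ)
    (hc : ∀ a st b, esize K (step a st b) ≤ esize K st + c * (esize K a + esize K b + 1)) :
    PolyTime K (fun a => (l a).foldl (step a) (init a)) := by
  obtain ⟨Pl, pl, hPl, kl⟩ := hl
  obtain ⟨Pi, pi, hPi, ki⟩ := hi
  obtain ⟨P, p, hP, k⟩ := hs
  -- Initial size plus one increment per list element; `pl` bounds both the length of the list and
  -- the size of each element.
  let S : Polynomial ℕ := pi + pl * (.C c * (.X + pl + 1))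
  refine ⟨.seq (.pair Pl (.pair .id Pi)) (.seq (.loop .head (.pair (.seq .head .tail)
    (.pair (.seq .tail .head) (.seq (.pair (.seq .tail .head) (.pair (.seq .tail .tail)
      (.seq .head .head))) P)))) (.seq .tail .tail)),
    pl + pi + pl * (p.comp (.X + S + pl + 2) + 30) + S + 20, ?_, fun x => ?_⟩
  · simp [Prog.Additive, hPl, hPi, hP]
  obtain ⟨⟨t, ht, et⟩, hsl⟩ := kl x
  obtain ⟨⟨u, hu, eu⟩, hsi⟩ := ki x
  have hlen : (l x).length ≤ pl.eval (esize K x) := (length_le_esize (K := K) (l x)).trans hsl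
  obtain ⟨⟨v, hv, ev⟩, hsv⟩ := loop_foldl c (fun y => (k y).1) hc x (S.eval (esize K x))
    (pl.eval (esize K x)) (l x) (fun b hb => (esize_le_of_mem hb).trans hsl) (init x) (by
      simp only [S, Polynomial.eval_add, Polynomial.eval_mul, Polynomial.eval_C,
        Polynomial.eval_X, Polynomial.eval_one]
      gcongr)
  have hv' : v ≤ pl.eval (esize K x) *
      (p.eval (esize K x + S.eval (esize K x) + pl.eval (esize K x) + 2) + 30) + 2 :=
    hv.trans (by gcongr)
  simp only [Polynomial.eval_add, Polynomial.eval_mul, Polynomial.eval_comp, Polynomial.eval_X,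
    Polynomial.eval_ofNat]
  exact ⟨⟨_, by omega, .seq (.pair et (.pair (.id _) eu)) (.seq ev (.seq (.tail _) (.tail _)))⟩,
    by omega⟩

theorem reverse {l : α → List β} (hl : PolyTime K l) : PolyTime K (fun a => (l a).reverse) := by
  simpa using foldl (step := fun _ st b => b :: st) hl nil
    (cons (snd (snd id)) (fst (snd id))) 1 (fun a st b => by simp; omega)

theorem map {l : α → List β} {f : β → γ} (hl : PolyTime K l) (hf : PolyTime K f) (c : ℕ)
    (hc : ∀ b, esize K (f b) ≤ c * (esize K b + 1)) : PolyTime K (fun a => (l a).map f) := by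
  have h := reverse (foldl (step := fun _ st b => f b :: st) hl nil
    (cons (comp hf (snd (snd id))) (fst (snd id))) (c + 1) (fun a st b => by
      have := hc b
      simp only [esize_list_cons]
      nlinarith))
  convert h using 2 with a
  suffices ∀ (l : List β) (r : List γ), (l.foldl (fun st b => f b :: st) r) =
      (l.map f).reverse ++ r by simp [this]
  intro l
  induction l with
  | nil => simp
  | cons b l ih => simp [ih]

end PolyTime

/-! ### Bit cost of additive programs -/

/-- All numbers in the datum satisfy `Q`. -/
def Datum.All {K : Type*} (Q : K → Prop) : Datum K → Prop
  | .nil => True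
  | .num x => Q x
  | .cons a b => a.All Q ∧ b.All Q

namespace Datum.All

variable {K : Type*} {Q R : K → Prop} {d : Datum K}

theorem head (h : d.All Q) : d.head.All Q := by cases d <;> simp_all [Datum.All, Datum.head]

theorem tail (h : d.All Q) : d.tail.All Q := by cases d <;> simp_all [Datum.All, Datum.tail]

theorem val [Zero K] (h : d.All Q) (h0 : Q 0) : Q d.val := by
  cases d <;> simp_all [Datum.All, Datum.val]

theorem mono (h : d.All Q) (hQR : ∀ x, Q x → R x) : d.All R := by
  induction d with
  | nil => trivial
  | num x => exact hQR _ h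
  | cons a b iha ihb => exact ⟨iha h.1, ihb h.2⟩

end Datum.All

theorem all_enc_list {K : Type*} {Q : K → Prop} {l : List K} (h : ∀ x ∈ l, Q x) :
    (Enc.enc l : Datum K).All Q := by
  induction l with
  | nil => trivial
  | cons x l ih => exact ⟨h x (by simp), ih fun y hy => h y (by simp [hy])⟩

theorem mem_of_all_enc_list {K : Type*} {Q : K → Prop} {l : List K}
    (h : (Enc.enc l : Datum K).All Q) : ∀ x ∈ l, Q x := by
  induction l with
  | nil => simp
  | cons x l ih =>
    intro y hy
    rcases List.mem_cons.1 hy with rfl | hy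
    · exact h.1
    · exact ih h.2 y hy

theorem all_le_result {K : Type*} {Q : K → Prop} {p : Prop} [Decidable p] :
    (if p then Datum.cons .nil .nil else .nil : Datum K).All Q := by
  split <;> simp [Datum.All]

theorem abs_mul_den (x : ℚ) : |x| * x.den = (x.num.natAbs : ℕ) := by
  rw [Nat.cast_natAbs, Int.cast_abs, ← Rat.mul_den_eq_num x, abs_mul, Nat.abs_cast]

/-- Rational numbers of absolute value at most `2 ^ M` whose denominators divide `D`. -/
def BoundedRat (D M : ℕ) (x : ℚ) : Prop := (∃ z : ℤ, x * D = z) ∧ |x| ≤ 2 ^ M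

namespace BoundedRat

variable {D M N : ℕ} {x y : ℚ}

theorem mono (h : BoundedRat D M x) (hMN : M ≤ N) : BoundedRat D N x :=
  ⟨h.1, h.2.trans (pow_le_pow_right₀ (by norm_num) hMN)⟩

theorem add (hx : BoundedRat D M x) (hy : BoundedRat D M y) : BoundedRat D (M + 1) (x + y) := by
  obtain ⟨⟨a, ha⟩, hx⟩ := hx
  obtain ⟨⟨b, hb⟩, hy⟩ := hy
  refine ⟨⟨a + b, by push_cast; rw [← ha, ← hb]; ring⟩, (abs_add_le x y).trans ?_⟩
  rw [pow_succ]; linarith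

theorem neg (hx : BoundedRat D M x) : BoundedRat D M (-x) := by
  obtain ⟨⟨a, ha⟩, hx⟩ := hx
  exact ⟨⟨-a, by push_cast; rw [← ha]; ring⟩, by rwa [abs_neg]⟩

theorem natCast {n : ℕ} (h : n ≤ 2 ^ M) : BoundedRat D M n :=
  ⟨⟨n * D, by push_cast; ring⟩, by rw [Nat.abs_cast]; exact_mod_cast h⟩

/-- The reduced denominator divides `D`, and the numerator is at most `2 ^ M * D` in absolute value.
-/
theorem bitCost_le (hD : D ≠ 0) (h : BoundedRat D M x) : bitCost x ≤ M + 1 + 2 * D.size := by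
  obtain ⟨⟨z, hz⟩, hx⟩ := h
  have hden : x.den ∣ D := by
    have hD' : (D : ℚ) ≠ 0 := by exact_mod_cast hD
    have : x = Rat.divInt z D := by
      rw [Rat.divInt_eq_div]
      field_simp
      exact_mod_cast hz
    rw [this]
    exact_mod_cast Rat.den_dvd z D
  have hle := Nat.le_of_dvd (Nat.pos_of_ne_zero hD) hden
  have hnum : x.num.natAbs ≤ 2 ^ M * D := by
    have h2 : |x| * x.den ≤ 2 ^ M * D := by gcongr
    rw [abs_mul_den] at h2
    exact_mod_cast h2
  have hs : x.num.natAbs.size ≤ M + D.size := by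
    rw [Nat.size_le, pow_add]
    exact hnum.trans_lt (Nat.mul_lt_mul_of_pos_left (Nat.lt_size_self D) (by positivity))
  have := Nat.size_le_size hle
  rw [bitCost]
  omega

theorem of_bitCost {B : ℕ} (h : bitCost x ≤ B) : |x| ≤ 2 ^ B := by
  have h1 : x.num.natAbs ≤ 2 ^ B :=
    (Nat.lt_size_self _).le.trans (Nat.pow_le_pow_right (by norm_num)
      ((Nat.le_add_right _ _).trans h))
  have h3 : (1 : ℚ) ≤ x.den := by exact_mod_cast x.den_pos
  have h4 : (x.num.natAbs : ℚ) ≤ 2 ^ B := by exact_mod_cast h1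
  calc |x| ≤ |x| * x.den := le_mul_of_one_le_right (abs_nonneg _) h3
    _ ≤ _ := abs_mul_den x ▸ h4

end BoundedRat

/-- An additive program has a bit cost that is at most its number of steps times a bound on the
lengths of the numbers. -/
theorem Eval.bitCost_of_unit {D : ℕ} (hD : D ≠ 0) {P : Prog} {d e : Datum ℚ} {t : ℕ}
    (h : Eval (fun _ : ℚ => 0) P d e t) : P.Additive → ∀ M, d.All (BoundedRat D M) →
      e.All (BoundedRat D (M + t)) ∧ ∀ N, M + t ≤ N →
        ∃ t' ≤ t * (1 + 3 * (N + 1 + 2 * D.size)), Eval bitCost P d e t' := by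
  have zero : ∀ M, BoundedRat D M 0 := fun M => by
    simpa using BoundedRat.natCast (D := D) (M := M) (n := 0) (by simp)
  have loosen : ∀ {d : Datum ℚ} {M N : ℕ}, d.All (BoundedRat D M) → M ≤ N →
      d.All (BoundedRat D N) := fun h hMN => h.mono fun x hx => hx.mono hMN
  induction h with
  | id d => exact fun _ M hd => ⟨loosen hd (by omega), fun N _ => ⟨1, by omega, .id _⟩⟩
  | nil d => exact fun _ M hd => ⟨trivial, fun N _ => ⟨1, by omega, .nil _⟩⟩
  | one d =>
    refine fun _ M hd => ⟨?_, fun N _ => ⟨1, by omega, .one _⟩⟩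
    simpa [Datum.All] using
      BoundedRat.natCast (D := D) (M := M + 1) (n := 1) Nat.one_le_two_pow
  | head d => exact fun _ M hd => ⟨loosen hd.head (by omega), fun N _ => ⟨1, by omega, .head _⟩⟩
  | tail d => exact fun _ M hd => ⟨loosen hd.tail (by omega), fun N _ => ⟨1, by omega, .tail _⟩⟩
  | arith o d =>
    intro ho M hd
    have h1 := hd.head.val (zero M)
    have h2 := hd.tail.val (zero M)
    -- Additivity enters here: sums and differences keep the common denominator `D` and at most
    -- double the magnitude. A product would add exponents, and repeated squaring would give
    -- exponentially long numbers.
    have h3 : BoundedRat D (M + 1) (o.apply d.head.val d.tail.val) := by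
      rcases ho with rfl | rfl
      · exact h1.add h2
      · simpa [ArithOp.apply, sub_eq_add_neg] using h1.add h2.neg
    refine ⟨h3, fun N hN => ⟨_, ?_, .arith _ _⟩⟩
    have h1' := h1.bitCost_le hD
    have h2' := h2.bitCost_le hD
    have h3' := h3.bitCost_le hD
    omega
  | le d =>
    intro _ M hd
    refine ⟨all_le_result, fun N hN => ⟨_, ?_, .le _⟩⟩
    have h1' := (hd.head.val (zero M)).bitCost_le hD
    have h2' := (hd.tail.val (zero M)).bitCost_le hD
    omega
  | pair _ _ ih1 ih2 =>
    intro hP M hd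
    obtain ⟨a1, b1⟩ := ih1 hP.1 M hd
    obtain ⟨a2, b2⟩ := ih2 hP.2 M hd
    refine ⟨⟨loosen a1 (by omega), loosen a2 (by omega)⟩, fun N hN => ?_⟩
    obtain ⟨t1, h1, e1⟩ := b1 N (by omega)
    obtain ⟨t2, h2, e2⟩ := b2 N (by omega)
    exact ⟨_, by nlinarith, .pair e1 e2⟩
  | seq _ _ ih1 ih2 =>
    intro hP M hd
    obtain ⟨a1, b1⟩ := ih1 hP.1 M hd
    obtain ⟨a2, b2⟩ := ih2 hP.2 _ a1
    refine ⟨loosen a2 (by omega), fun N hN => ?_⟩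
    obtain ⟨t1, h1, e1⟩ := b1 N (by omega)
    obtain ⟨t2, h2, e2⟩ := b2 N (by omega)
    exact ⟨_, by nlinarith, .seq e1 e2⟩
  | ite_true _ hb _ ih1 ih2 =>
    intro hP M hd
    obtain ⟨a1, b1⟩ := ih1 hP.1 M hd
    obtain ⟨a2, b2⟩ := ih2 hP.2.1 M hd
    refine ⟨loosen a2 (by omega), fun N hN => ?_⟩
    obtain ⟨t1, h1, e1⟩ := b1 N (by omega)
    obtain ⟨t2, h2, e2⟩ := b2 N (by omega)
    exact ⟨_, by nlinarith, .ite_true e1 hb e2⟩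
  | ite_false _ _ ih1 ih2 =>
    intro hP M hd
    obtain ⟨a1, b1⟩ := ih1 hP.1 M hd
    obtain ⟨a2, b2⟩ := ih2 hP.2.2 M hd
    refine ⟨loosen a2 (by omega), fun N hN => ?_⟩
    obtain ⟨t1, h1, e1⟩ := b1 N (by omega)
    obtain ⟨t2, h2, e2⟩ := b2 N (by omega)
    exact ⟨_, by nlinarith, .ite_false e1 e2⟩
  | loop_stop _ ih1 =>
    intro hP M hd
    obtain ⟨a1, b1⟩ := ih1 hP.1 M hd
    refine ⟨loosen hd (by omega), fun N hN => ?_⟩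
    obtain ⟨t1, h1, e1⟩ := b1 N (by omega)
    exact ⟨_, by nlinarith, Eval.loop_stop e1⟩
  | loop_step _ hb _ _ ih1 ih2 ih3 =>
    intro hP M hd
    obtain ⟨a1, b1⟩ := ih1 hP.1 M hd
    obtain ⟨a2, b2⟩ := ih2 hP.2 M hd
    obtain ⟨a3, b3⟩ := ih3 hP _ a2
    refine ⟨loosen a3 (by omega), fun N hN => ?_⟩
    obtain ⟨t1, h1, e1⟩ := b1 N (by omega)
    obtain ⟨t2, h2, e2⟩ := b2 N (by omega)
    obtain ⟨t3, h3, e3⟩ := b3 N (by omega)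
    exact ⟨_, by nlinarith, .loop_step e1 hb e2 e3⟩

/-- The numbers that a program outputs are input numbers, or are at most as long as its running
time allows. -/
theorem Eval.all_bitCost_le {P : Prog} {d e : Datum ℚ} {t : ℕ} (h : Eval bitCost P d e t) :
    ∀ M, 2 ≤ M → d.All (bitCost · ≤ M) → e.All (bitCost · ≤ M + t) := by
  have loosen : ∀ {d : Datum ℚ} {M N : ℕ}, d.All (bitCost · ≤ M) → M ≤ N →
      d.All (bitCost · ≤ N) := fun h hMN => h.mono fun x hx => hx.trans hMN
  induction h with
  | id d => exact fun M _ hd => loosen hd (by omega)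
  | nil d => exact fun M _ hd => trivial
  | one d =>
    intro M hM _
    have : bitCost 1 = 2 := by simp [bitCost]
    change bitCost 1 ≤ _
    omega
  | head d => exact fun M _ hd => loosen hd.head (by omega)
  | tail d => exact fun M _ hd => loosen hd.tail (by omega)
  | arith o d =>
    intro M _ _
    change bitCost _ ≤ _
    omega
  | le d => exact fun M _ _ => all_le_result
  | pair _ _ ih1 ih2 =>
    exact fun M hM hd => ⟨loosen (ih1 M hM hd) (by omega), loosen (ih2 M hM hd) (by omega)⟩
  | seq _ _ ih1 ih2 =>
    exact fun M hM hd => loosen (ih2 _ (by omega) (ih1 M hM hd)) (by omega)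
  | ite_true _ _ _ _ ih2 => exact fun M hM hd => loosen (ih2 M hM hd) (by omega)
  | ite_false _ _ _ ih2 => exact fun M hM hd => loosen (ih2 M hM hd) (by omega)
  | loop_stop _ _ => exact fun M hM hd => loosen hd (by omega)
  | loop_step _ _ _ _ _ ih2 ih3 =>
    exact fun M hM hd => loosen (ih3 _ (by omega) (ih2 M hM hd)) (by omega)

/-! ### The algorithm

Items are pairs of a size and an index; packed items are triples of an index, a size and the
label of a bin. -/

section Algorithm

variable {K : Type*} [Field K] [LinearOrder K]

/-- The items of an instance, with their indices. -/
def indexed (l : List K) : List (K × K) :=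
  (l.foldl (fun st s => (st.1 + 1, (s, st.1) :: st.2)) ((0 : K), ([] : List (K × K)))).2

/-- A list whose length is the rounded down sum of `l`. -/
def ticks (l : List K) : List Unit :=
  (l.foldl (fun st s => if 1 ≤ st.1 + s then (st.1 + s - 1, () :: st.2) else (st.1 + s, st.2))
    ((0 : K), ([] : List Unit))).2

/-- The multiple of `x` by the length of `U`. -/
def lengthMul (U : List Unit) (x : K) : K :=
  U.foldl (fun acc _ => acc + x) 0

/-- Separate the items of size at least `1 / U.length` from the others. -/
def split (U : List Unit) (l : List (K × K)) : List (K × K) × List (K × K) :=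
  l.foldl (fun st x => if 1 ≤ lengthMul U x.1 then (x :: st.1, st.2) else (st.1, x :: st.2))
    ([], [])

/-- Move `st.1` through the list, always keeping the smaller key. -/
def bubble {β : Type*} (st : (K × β) × List (K × β)) (y : K × β) : (K × β) × List (K × β) :=
  if y.1 ≤ st.1.1 then (y, st.1 :: st.2) else (st.1, y :: st.2)

/-- Insert into a list with decreasing keys. -/
def insertKey {β : Type*} (l : List (K × β)) (x : K × β) : List (K × β) :=
  ((l.foldl bubble (x, [])).1 :: (l.foldl bubble (x, [])).2).reverse

/-- Sort by decreasing keys. -/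
def sortKey {β : Type*} (l : List (K × β)) : List (K × β) :=
  l.foldl insertKey []

/-- The state of the grouping procedure: the total size and the number of the items of the
current group, the largest number of items of a group so far, and the largest size in the
current group; the kept items with their rounded sizes, and the other items. -/
abbrev GroupState (K : Type*) := (K × K × K × K) × (List (K × K × K) × List (K × K))

/-- Start a new group with an item of size `x` if the current group is full. -/
def openGroup (st : GroupState K) (x : K) : GroupState K :=
  if 1 ≤ st.1.1 then ((0, 0, st.1.2.2.1, x), st.2) else st

/-- Put an item into the current group. -/
def putItem (st : GroupState K) (x : K × K) : GroupState K :=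
  if st.1.2.1 + 1 ≤ st.1.2.2.1 then
    ((st.1.1 + x.1, st.1.2.1 + 1, st.1.2.2.1, st.1.2.2.2),
      ((st.1.2.2.2, x) :: st.2.1, st.2.2))
  else
    ((st.1.1 + x.1, st.1.2.1 + 1, st.1.2.1 + 1, st.1.2.2.2), (st.2.1, x :: st.2.2))

/-- One step of the grouping procedure. -/
def groupStep (st : GroupState K) (x : K × K) : GroupState K :=
  putItem (openGroup st x.1) x

/-- Group the items of a list with decreasing sizes, and round the sizes up to the largest size
of the group. An item is not kept if all earlier groups are too small to have an item at its
position. -/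
def group (l : List (K × K)) : GroupState K :=
  l.foldl groupStep ((0, 0, 0, 0), ([], []))

/-- Attach labels to items. -/
def attach (l : List (K × K × K)) (a : List K) : List (K × K × K) :=
  (l.foldl (fun st x => (st.1.tail, (x.2.2, x.2.1, st.1.headD 0) :: st.2)) (a, [])).2

/-- The load of the bin with label `b`. -/
def load (T : List (K × K × K)) (b : K) : K :=
  T.foldl (fun acc e => if e.2.2 ≤ b then if b ≤ e.2.2 then acc + e.2.1 else acc else acc) 0

/-- A new label. -/
def freshLabel (T : List (K × K × K)) : K :=
  T.foldl (fun acc e => acc + e.2.2) 1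

/-- The label of a bin that has room for an item of size `z`. -/
def chooseLabel (T : List (K × K × K)) (z : K) : K :=
  T.foldl (fun c e => if load T e.2.2 + z ≤ 1 then e.2.2 else c) (freshLabel T)

/-- Pack one more item. -/
def place (T : List (K × K × K)) (x : K × K) : List (K × K × K) :=
  (x.2, x.1, chooseLabel T x.1) :: T

/-- Large items are grouped, small items are not. -/
def prepare (l : List K) : (List (K × K × K) × List (K × K)) × List (K × K) :=
  ((group (sortKey (split (ticks l) (indexed l)).1)).2, (split (ticks l) (indexed l)).2)

/-- Complete the packing with labels `a` of the kept items. -/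
def complete (k : List (K × K × K)) (d s : List (K × K)) (a : List K) : List (K × K × K) :=
  s.foldl place (d.foldl place (attach k a))

/-- The labels of packed items, in the order of the items. -/
def labelsInOrder (T : List (K × K × K)) : List K :=
  ((sortKey T).map fun e => e.2.2).reverse

/-! ### Sorting permutes its input. -/

section

variable {K β : Type*} [LinearOrder K]

theorem bubble_perm (l : List (K × β)) : ∀ (x : K × β) (r : List (K × β)),
    ((l.foldl bubble (x, r)).1 :: (l.foldl bubble (x, r)).2).Perm (x :: l ++ r) := by
  induction l with
  | nil => simp
  | cons y l ih =>
    intro x r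
    simp only [List.foldl_cons, bubble]
    split
    · refine (ih _ _).trans ?_
      simp only [List.cons_append]
      exact (List.perm_middle.cons y).trans (.swap _ _ _)
    · refine (ih _ _).trans ?_
      simp only [List.cons_append]
      exact List.perm_middle.cons x

theorem insertKey_perm (l : List (K × β)) (x : K × β) : (insertKey l x).Perm (x :: l) :=
  (List.reverse_perm _).trans (by simpa using bubble_perm l x [])

theorem sortKey_perm (l : List (K × β)) : (sortKey l).Perm l := by
  have : ∀ r : List (K × β), (l.foldl insertKey r).Perm (l ++ r) := by
    induction l with
    | nil => simp
    | cons x l ih =>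
      intro r
      exact (ih _).trans (((insertKey_perm r x).append_left l).trans List.perm_middle)
  simpa [sortKey] using this []

end

/-! ### Polynomial running time of each phase. -/

open PolyTime

variable {α β : Type*} [Enc K α] [Enc K β]

theorem polyTime_indexed : PolyTime K (indexed : List K → List (K × K)) :=
  snd (foldl (step := fun _ st s => (st.1 + 1, (s, st.1) :: st.2)) id (prodMk zero nil)
    (prodMk (add (fst (fst (snd id))) one)
      (cons (prodMk (snd (snd id)) (fst (fst (snd id)))) (snd (fst (snd id))))) 4
    (fun a st b => by simp; omega))

theorem polyTime_ticks : PolyTime K (ticks : List K → List Unit) :=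
  have h : PolyTime K fun x : List K × (K × List Unit) × K => x.2.1.1 + x.2.2 :=
    add (fst (fst (snd id))) (snd (snd id))
  snd (foldl (step := fun _ st s =>
      if 1 ≤ st.1 + s then (st.1 + s - 1, () :: st.2) else (st.1 + s, st.2))
    id (prodMk zero nil)
    (ite_le one h (prodMk (sub h one) (cons unit (snd (fst (snd id)))))
      (prodMk h (snd (fst (snd id))))) 4
    (fun a st b => by split <;> simp; omega))

theorem polyTime_lengthMul {U : α → List Unit} {x : α → K} (hU : PolyTime K U)
    (hx : PolyTime K x) : PolyTime K fun a => lengthMul (U a) (x a) :=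
  foldl (step := fun a acc _ => acc + x a) hU zero
    (add (fst (snd id)) (comp hx (fst id))) 1 (fun a st b => by simp)

theorem polyTime_split {U : α → List Unit} {l : α → List (K × K)} (hU : PolyTime K U)
    (hl : PolyTime K l) : PolyTime K fun a => split (U a) (l a) := by
  have hm : PolyTime K fun x : α × (List (K × K) × List (K × K)) × (K × K) =>
      lengthMul (U x.1) x.2.2.1 :=
    polyTime_lengthMul (comp hU (fst id)) (fst (snd (snd id)))
  unfold split
  exact foldl (step := fun a st x =>
      if 1 ≤ lengthMul (U a) x.1 then (x :: st.1, st.2) else (st.1, x :: st.2))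
    hl (prodMk nil nil)
    (ite_le one hm
      (prodMk (cons (snd (snd id)) (fst (fst (snd id)))) (snd (fst (snd id))))
      (prodMk (fst (fst (snd id))) (cons (snd (snd id)) (snd (fst (snd id)))))) 1
    (fun a st b => by split <;> simp <;> omega)

theorem polyTime_sortKey : PolyTime K (sortKey : List (K × β) → List (K × β)) := by
  have hb : PolyTime K fun x : (List (K × β) × (K × β)) × ((K × β) × List (K × β)) × (K × β) =>
      bubble x.2.1 x.2.2 :=
    ite_le (fst (snd (snd id))) (fst (fst (fst (snd id))))
      (prodMk (snd (snd id)) (cons (fst (fst (snd id))) (snd (fst (snd id)))))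
      (prodMk (fst (fst (snd id))) (cons (snd (snd id)) (snd (fst (snd id)))))
  have hf : PolyTime K fun x : List (K × β) × (K × β) => x.1.foldl bubble (x.2, []) :=
    foldl (step := fun _ st y => bubble st y) (fst id) (prodMk (snd id) nil) hb 1
      (fun a st b => by simp only [bubble]; split <;> simp <;> omega)
  have hi : PolyTime K fun x : List (K × β) × (K × β) => insertKey x.1 x.2 :=
    reverse (cons (fst hf) (snd hf))
  have hi' : PolyTime K fun x : List (K × β) × List (K × β) × (K × β) => insertKey x.2.1 x.2.2 :=
    comp (g := fun x : List (K × β) × (K × β) => insertKey x.1 x.2) hi (snd id)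
  exact foldl (step := fun _ st y => insertKey st y) id nil hi' 1
    (fun a st b => by
      rw [esize_perm (insertKey_perm st b)]
      simp only [esize_list_cons]
      omega)

theorem polyTime_openGroup :
    PolyTime K fun x : GroupState K × (K × K) => openGroup x.1 x.2.1 := by
  have h : PolyTime K fun x : GroupState K × (K × K) => x.1.1.2.2.1 :=
    fst (snd (snd (fst (fst id))))
  unfold openGroup
  exact ite_le one (fst (fst (fst id)))
    (prodMk (prodMk zero (prodMk zero (prodMk h (fst (snd id))))) (snd (fst id))) (fst id)

theorem polyTime_putItem : PolyTime K fun x : GroupState K × (K × K) => putItem x.1 x.2 := by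
  have h1 : PolyTime K fun x : GroupState K × (K × K) => x.1.1.2.1 + 1 :=
    add (fst (snd (fst (fst id)))) one
  have h2 : PolyTime K fun x : GroupState K × (K × K) => x.1.1.2.2.1 :=
    fst (snd (snd (fst (fst id))))
  have h3 : PolyTime K fun x : GroupState K × (K × K) => x.1.1.2.2.2 :=
    snd (snd (snd (fst (fst id))))
  have h4 : PolyTime K fun x : GroupState K × (K × K) => x.1.1.1 + x.2.1 :=
    add (fst (fst (fst id))) (fst (snd id))
  have h5 : PolyTime K fun x : GroupState K × (K × K) => x.1.2.1 := fst (snd (fst id))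
  have h6 : PolyTime K fun x : GroupState K × (K × K) => x.1.2.2 := snd (snd (fst id))
  have h7 : PolyTime K fun x : GroupState K × (K × K) => x.2 := snd id
  unfold putItem
  exact ite_le h1 h2 (prodMk (prodMk h4 (prodMk h1 (prodMk h2 h3)))
      (prodMk (cons (prodMk h3 h7) h5) h6))
    (prodMk (prodMk h4 (prodMk h1 (prodMk h1 h3))) (prodMk h5 (cons h7 h6)))

theorem esize_openGroup (st : GroupState K) (x : K) :
    esize K (openGroup st x) = esize K st := by
  unfold openGroup
  split <;> simp

theorem esize_putItem_le (st : GroupState K) (x : K × K) :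
    esize K (putItem st x) ≤ esize K st + 6 := by
  unfold putItem
  split <;> simp <;> omega

theorem polyTime_groupStep :
    PolyTime K fun x : GroupState K × (K × K) => groupStep x.1 x.2 :=
  comp (g := fun x : GroupState K × (K × K) => putItem x.1 x.2) polyTime_putItem
    (prodMk polyTime_openGroup (snd id))

theorem polyTime_group : PolyTime K (group : List (K × K) → GroupState K) := by
  have hs : PolyTime K fun x : List (K × K) × GroupState K × (K × K) =>
      groupStep x.2.1 x.2.2 :=
    comp (g := fun x : GroupState K × (K × K) => groupStep x.1 x.2) polyTime_groupStep (snd id)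
  have hi : PolyTime K fun _ : List (K × K) => (((0, 0, 0, 0), ([], [])) : GroupState K) :=
    prodMk (prodMk zero (prodMk zero (prodMk zero zero))) (prodMk nil nil)
  have hc : ∀ (a : List (K × K)) (st : GroupState K) (x : K × K),
      esize K (groupStep st x) ≤ esize K st + 6 * (esize K a + esize K x + 1) := fun a st x =>
    (esize_putItem_le _ _).trans (by rw [esize_openGroup]; omega)
  exact foldl (step := fun _ => groupStep) id hi hs 6 hc

theorem polyTime_attach {l : α → List (K × K × K)} {a : α → List K} (hl : PolyTime K l)
    (ha : PolyTime K a) : PolyTime K fun x => attach (l x) (a x) :=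
  snd (foldl (step := fun _ st x => (st.1.tail, (x.2.2, x.2.1, st.1.headD 0) :: st.2)) hl
    (prodMk ha nil)
    (prodMk (tail (fst (fst (snd id)))) (cons (prodMk (snd (snd (snd (snd id))))
      (prodMk (fst (snd (snd (snd id)))) (headD (fst (fst (snd id))))))
      (snd (fst (snd id))))) 6
    (fun a st b => by
      obtain ⟨_ | _, _⟩ := st <;> simp <;> omega))

theorem polyTime_load {T : α → List (K × K × K)} {b : α → K} (hT : PolyTime K T)
    (hb : PolyTime K b) : PolyTime K fun x => load (T x) (b x) := by
  have h : PolyTime K fun x : α × K × (K × K × K) => x.2.2.2.2 := snd (snd (snd (snd id)))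
  have h' : PolyTime K fun x : α × K × (K × K × K) => b x.1 := comp hb (fst id)
  unfold load
  exact foldl (step := fun x acc e =>
      if e.2.2 ≤ b x then if b x ≤ e.2.2 then acc + e.2.1 else acc else acc) hT zero
    (ite_le h h' (ite_le h' h (add (fst (snd id)) (fst (snd (snd (snd id)))))
      (fst (snd id))) (fst (snd id))) 0 (fun a st b => by simp)

theorem polyTime_chooseLabel {T : α → List (K × K × K)} {z : α → K} (hT : PolyTime K T)
    (hz : PolyTime K z) : PolyTime K fun x => chooseLabel (T x) (z x) := by
  have h : PolyTime K fun x : α × K × (K × K × K) => x.2.2.2.2 := snd (snd (snd (snd id)))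
  have hf : PolyTime K fun x => freshLabel (T x) := by
    unfold freshLabel
    exact foldl (step := fun _ acc e => acc + e.2.2) hT one (add (fst (snd id)) h) 0
      (fun a st b => by simp)
  have hl : PolyTime K fun x : α × K × (K × K × K) => load (T x.1) x.2.2.2.2 + z x.1 :=
    add (polyTime_load (comp hT (fst id)) h) (comp hz (fst id))
  unfold chooseLabel
  exact foldl (step := fun x c e => if load (T x) e.2.2 + z x ≤ 1 then e.2.2 else c) hT hf
    (ite_le hl one h (fst (snd id))) 0 (fun a st b => by simp)

theorem polyTime_foldl_place {l : α → List (K × K)} {T : α → List (K × K × K)}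
    (hl : PolyTime K l) (hT : PolyTime K T) : PolyTime K fun x => (l x).foldl place (T x) :=
  foldl (step := fun _ T x => place T x) hl hT
    (cons (prodMk (snd (snd (snd id))) (prodMk (fst (snd (snd id)))
      (polyTime_chooseLabel (fst (snd id)) (fst (snd (snd id)))))) (fst (snd id))) 5
    (fun a st b => by simp [place]; omega)

theorem polyTime_prepare :
    PolyTime K (prepare : List K → (List (K × K × K) × List (K × K)) × List (K × K)) :=
  have h := polyTime_split (K := K) polyTime_ticks polyTime_indexed
  prodMk (snd (comp polyTime_group (comp polyTime_sortKey (fst h)))) (snd h)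

theorem polyTime_labelsInOrder :
    PolyTime K (labelsInOrder : List (K × K × K) → List K) :=
  reverse (map polyTime_sortKey (snd (snd id)) 1 (fun b => by simp))

theorem polyTime_complete :
    PolyTime K fun x : ((List (K × K × K) × List (K × K)) × List (K × K)) × List K =>
      labelsInOrder (complete x.1.1.1 x.1.1.2 x.1.2 x.2) :=
  comp polyTime_labelsInOrder (polyTime_foldl_place (snd (fst id))
    (polyTime_foldl_place (snd (fst (fst id)))
      (polyTime_attach (fst (fst (fst id))) (snd id))))

end Algorithm

/-! ### Correctness of sorting, splitting and grouping -/

section Sorting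

variable {K β : Type*} [LinearOrder K]

/-- Invariant: the unread list decreases, the output `r` increases, and every key in `r` dominates
the carried key and all unread ones. The carried element can therefore always be put in front of
`r`; the reversal in `insertKey` restores decreasing order. -/
theorem bubble_sorted (l : List (K × β)) : ∀ (x : K × β) (r : List (K × β)),
    l.Pairwise (fun a b => b.1 ≤ a.1) → r.Pairwise (fun a b => a.1 ≤ b.1) →
    (∀ y ∈ r, x.1 ≤ y.1 ∧ ∀ z ∈ l, z.1 ≤ y.1) →
    ((l.foldl bubble (x, r)).1 :: (l.foldl bubble (x, r)).2).Pairwise (fun a b => a.1 ≤ b.1) := by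
  induction l with
  | nil =>
    intro x r _ hr h
    exact List.pairwise_cons.2 ⟨fun y hy => (h y hy).1, hr⟩
  | cons w l ih =>
    intro x r hl hr h
    obtain ⟨hw, hl⟩ := List.pairwise_cons.1 hl
    simp only [List.foldl_cons, bubble]
    split
    next hwx =>
      refine ih _ _ hl (List.pairwise_cons.2 ⟨fun y hy => (h y hy).1, hr⟩) fun y hy => ?_
      rcases List.mem_cons.1 hy with rfl | hy
      · exact ⟨hwx, fun z hz => (hw z hz).trans hwx⟩
      · exact ⟨(h y hy).2 w (by simp), fun z hz => (h y hy).2 z (by simp [hz])⟩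
    next hwx =>
      refine ih _ _ hl (List.pairwise_cons.2 ⟨fun y hy => (h y hy).2 w (by simp), hr⟩)
        fun y hy => ?_
      rcases List.mem_cons.1 hy with rfl | hy
      · exact ⟨(not_le.1 hwx).le, hw⟩
      · exact ⟨(h y hy).1, fun z hz => (h y hy).2 z (by simp [hz])⟩

theorem sortKey_sorted (l : List (K × β)) : (sortKey l).Pairwise (fun a b => b.1 ≤ a.1) := by
  have : ∀ r : List (K × β), r.Pairwise (fun a b => b.1 ≤ a.1) →
      (l.foldl insertKey r).Pairwise (fun a b => b.1 ≤ a.1) := by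
    induction l with
    | nil => simp
    | cons x l ih =>
      exact fun r hr => ih _ (List.pairwise_reverse.2 (bubble_sorted r x [] hr (by simp) (by simp)))
  exact this [] (by simp)

end Sorting

section Correctness

variable {K : Type*} [Field K]

theorem indexed_perm {m : ℕ} (s : Fin m → K) :
    (indexed (List.ofFn s)).Perm (List.ofFn fun i => (s i, ((i : ℕ) : K))) := by
  have h : ∀ (l : List K) (k : ℕ) (r : List (K × K)),
      (l.foldl (fun st s => (st.1 + 1, (s, st.1) :: st.2)) ((k : K), r)).2 =
        ((l.zipIdx k).map fun x => (x.1, (x.2 : K))).reverse ++ r := by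
    intro l
    induction l with
    | nil => simp
    | cons x l ih =>
      intro k r
      have := ih (k + 1) ((x, (k : K)) :: r)
      push_cast at this
      simp [this]
  have h0 := h (List.ofFn s) 0 []
  rw [Nat.cast_zero] at h0
  rw [indexed, h0, List.append_nil]
  refine (List.reverse_perm _).trans (List.Perm.of_eq ?_)
  apply List.ext_getElem <;> simp

theorem lengthMul_eq (U : List Unit) (x : K) : lengthMul U x = U.length * x := by
  have h : ∀ (U : List Unit) (c : K), U.foldl (fun acc _ => acc + x) c = c + U.length * x := by
    intro U
    induction U with
    | nil => simp
    | cons _ U ih =>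
      intro c
      simp only [List.foldl_cons, ih, List.length_cons]
      push_cast
      ring
  simpa [lengthMul] using h U 0

variable [LinearOrder K]

theorem split_spec (U : List Unit) (l : List (K × K)) :
    ((split U l).1 ++ (split U l).2).Perm l ∧ (∀ x ∈ (split U l).1, 1 ≤ U.length * x.1) ∧
      ∀ x ∈ (split U l).2, U.length * x.1 < 1 := by
  have h : ∀ (l : List (K × K)) (st : List (K × K) × List (K × K)),
      (∀ x ∈ st.1, 1 ≤ U.length * x.1) → (∀ x ∈ st.2, U.length * x.1 < 1) →
      ∀ r, (l.foldl (fun st x =>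
        if 1 ≤ lengthMul U x.1 then (x :: st.1, st.2) else (st.1, x :: st.2)) st) = r →
      (r.1 ++ r.2).Perm (l ++ (st.1 ++ st.2)) ∧
        (∀ x ∈ r.1, 1 ≤ U.length * x.1) ∧ ∀ x ∈ r.2, U.length * x.1 < 1 := by
    intro l
    induction l with
    | nil => rintro st h1 h2 _ rfl; exact ⟨by simp, h1, h2⟩
    | cons x l ih =>
      intro st h1 h2 r hr
      rw [List.foldl_cons, lengthMul_eq] at hr
      split_ifs at hr with hx
      · obtain ⟨a, b, c⟩ := ih (x :: st.1, st.2) (by simpa [hx] using h1) h2 r hr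
        exact ⟨a.trans List.perm_middle, b, c⟩
      · obtain ⟨a, b, c⟩ := ih (st.1, x :: st.2) h1
          (by simpa [not_le.1 hx] using h2) r hr
        refine ⟨a.trans (.trans ?_ List.perm_middle), b, c⟩
        exact List.perm_middle.append_left l
  simpa [split] using h l ([], []) (by simp) (by simp) _ rfl

variable [IsStrictOrderedRing K]

theorem ticks_length {l : List K} (hl : ∀ x ∈ l, 0 ≤ x ∧ x ≤ 1) :
    ((ticks l).length : K) ≤ l.sum ∧ l.sum < (ticks l).length + 1 := by
  -- The accumulator stays in `[0, 1)`, and accumulator plus number of ticks is the sum read so far.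
  have h : ∀ (l : List K) (st : K × List Unit), (∀ x ∈ l, 0 ≤ x ∧ x ≤ 1) → 0 ≤ st.1 → st.1 < 1 →
      ∃ r : K, 0 ≤ r ∧ r < 1 ∧ st.1 + st.2.length + l.sum = r + ((l.foldl (fun st s =>
        if 1 ≤ st.1 + s then (st.1 + s - 1, () :: st.2) else (st.1 + s, st.2)) st).2.length : K) := by
    intro l
    induction l with
    | nil => exact fun st _ h0 h1 => ⟨st.1, h0, h1, by simp⟩
    | cons x l ih =>
      intro st hl h0 h1
      have hx := hl x (by simp)
      rw [List.foldl_cons]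
      split_ifs with h
      · obtain ⟨r, hr, hr', e⟩ := ih (st.1 + x - 1, () :: st.2) (fun y hy => hl y (by simp [hy]))
          (by simpa using h) (by dsimp only; linarith)
        refine ⟨r, hr, hr', e ▸ ?_⟩
        simp only [List.sum_cons, List.length_cons]
        push_cast
        ring
      · obtain ⟨r, hr, hr', e⟩ := ih (st.1 + x, st.2) (fun y hy => hl y (by simp [hy]))
          (by dsimp only; linarith) (by simpa using h)
        refine ⟨r, hr, hr', e ▸ ?_⟩
        simp only [List.sum_cons]
        ring
  obtain ⟨r, hr, hr', e⟩ := h l ((0 : K), []) hl le_rfl one_pos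
  change _ = r + ((ticks l).length : K) at e
  simp only [List.length_nil, Nat.cast_zero, add_zero, zero_add] at e
  constructor <;> linarith

/-- The invariant of the grouping procedure, when the items in `pr` have been processed. The
current group has `p` items, the longest group so far has `N` items, and `k` groups are
complete. The kept items are dominated by the sizes `M`; of the other sizes, those in `old` are
from earlier groups and those in `new` are from the current group. -/
structure GroupInv (n : ℕ) (pr : List (K × K)) (seen : List K) (st : GroupState K) (p N k : ℕ)
    (M old new : List K) (Z : Finset K) : Prop where
  position : st.1.2.1 = p
  longest : st.1.2.2.1 = N
  position_le : p ≤ N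
  longest_le : N ≤ 2 * n
  nonneg : 0 ≤ st.1.1
  mul_le : ∀ y, (∀ x ∈ pr, y ≤ x.1) → p * y ≤ st.1.1
  rest_sum : (st.2.2.map Prod.fst).sum ≤ 2 * ∑ i ∈ Finset.range N, ((i : K) + 1)⁻¹
  card_le : Z.card ≤ k
  complete_le : k + st.1.1 ≤ (pr.map Prod.fst).sum
  rounded_mem : ∀ x ∈ st.2.1, x.1 ∈ Z
  -- A leader matters only while its group can still keep an item. In the first group `p = N`
  -- throughout, so its leader is never counted; this is why `Z` has at most as many elements as
  -- there are complete groups.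
  leader_mem : p < N → st.1.2.2.2 ∈ Z
  kept_spec : ∀ x ∈ st.2.1, x.2.1 ≤ x.1 ∧ x.1 ∈ seen
  leader_seen : p < N → st.1.2.2.2 ∈ seen
  -- `M` lists the sizes already used as partners of kept items. By `old_length`, the unused earlier
  -- sizes are as many as the positions of the current group still below `N`, so a partner never
  -- runs out.
  dominated : List.Forall₂ (· ≤ ·) (st.2.1.map Prod.fst) M
  sizes_perm : (M ++ (old ++ new)).Perm (pr.map Prod.fst)
  old_length : old.length + p = N
  new_length : new.length = p
  leader_le : ∀ y ∈ old, st.1.2.2.2 ≤ y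
  items_perm : (st.2.1.map Prod.snd ++ st.2.2).Perm pr

/-- A full group pays one unit of total size for the increase of `k`, and its unused sizes join
`old`. The new leader is at most all sizes processed so far, hence at most every size in `old`. -/
theorem GroupInv.openGroup {n : ℕ} {pr : List (K × K)} {st : GroupState K} {p N k : ℕ}
    {M old new : List K} {Z : Finset K}
    (h : GroupInv n pr (pr.map Prod.fst) st p N k M old new Z) {x : K}
    (hx : ∀ y ∈ pr, x ≤ y.1) :
    ∃ p k old new Z, (openGroup st x).1.1 < 1 ∧
      GroupInv n pr (x :: pr.map Prod.fst) (openGroup st x) p N k M old new Z := by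
  unfold BinPacking.openGroup
  split_ifs with hg
  · refine ⟨0, k + 1, old ++ new, [], insert x Z, by simp, ?_⟩
    have hsum := h.complete_le
    constructor
    · simp
    · exact h.longest
    · simp
    · exact h.longest_le
    · simp
    · simp
    · exact h.rest_sum
    · exact (Finset.card_insert_le _ _).trans (by simpa using h.card_le)
    · push_cast
      linarith
    · exact fun y hy => Finset.mem_insert_of_mem (h.rounded_mem y hy)
    · simp
    · exact fun y hy => ⟨(h.kept_spec y hy).1, List.mem_cons_of_mem _ (h.kept_spec y hy).2⟩
    · simp
    · exact h.dominated
    · simpa using h.sizes_perm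
    · have := h.old_length
      have := h.new_length
      simp
      omega
    · simp
    · intro y hy
      have : y ∈ pr.map Prod.fst := h.sizes_perm.subset (List.mem_append_right _ hy)
      obtain ⟨z, hz, rfl⟩ := List.mem_map.1 this
      exact hx z hz
    · exact h.items_perm
  · exact ⟨p, k, old, new, Z, not_le.1 hg, { h with
      kept_spec := fun y hy => ⟨(h.kept_spec y hy).1, List.mem_cons_of_mem _ (h.kept_spec y hy).2⟩
      leader_seen := fun hp => List.mem_cons_of_mem _ (h.leader_seen hp) }⟩

/-- If the position is below `N`, a size from `old` becomes the partner of the item; it is at least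
the leader, which is the rounded size. Otherwise `p = N`, so `old` is empty, the item is discarded
and the record length grows by one. -/
theorem GroupInv.putItem {n : ℕ} {pr : List (K × K)} {st : GroupState K} {p N k : ℕ}
    {M old new : List K} {Z : Finset K} {x : K × K}
    (h : GroupInv n pr (x.1 :: pr.map Prod.fst) st p N k M old new Z) (hg : st.1.1 < 1)
    (hx : ∀ y ∈ pr, x.1 ≤ y.1) (h0 : 0 ≤ x.1) (h1 : x.1 ≤ 1) (hn : 1 ≤ n * x.1) :
    ∃ p N k M old new Z,
      GroupInv n (x :: pr) ((x :: pr).map Prod.fst) (putItem st x) p N k M old new Z := by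
  have hmul : ∀ y, (∀ z ∈ x :: pr, y ≤ z.1) → ((p + 1 : ℕ) : K) * y ≤ st.1.1 + x.1 := by
    intro y hy
    have := h.mul_le y fun z hz => hy z (by simp [hz])
    have := hy x (by simp)
    push_cast
    linarith
  have hsum : (k : K) + (st.1.1 + x.1) ≤ ((x :: pr).map Prod.fst).sum := by
    have := h.complete_le
    simp only [List.map_cons, List.sum_cons]
    linarith
  have hpos := h.position
  have hlong := h.longest
  have hnn := h.nonneg
  unfold BinPacking.putItem
  rw [h.position, h.longest]
  split_ifs with hp
  · have hp' : p + 1 ≤ N := by exact_mod_cast hp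
    obtain ⟨y, old, rfl⟩ : ∃ y t, old = y :: t := by
      cases old with
      | nil => have := h.old_length; simp at this; omega
      | cons y t => exact ⟨y, t, rfl⟩
    have hlead : x.1 ≤ st.1.2.2.2 := by
      rcases List.mem_cons.1 (h.leader_seen hp') with h | h
      · exact h.ge
      · obtain ⟨z, hz, e⟩ := List.mem_map.1 h
        exact e ▸ hx z hz
    refine ⟨p + 1, N, k, y :: M, old, x.1 :: new, Z, ?_⟩
    constructor
    · simp
    · simp
    · exact hp'
    · exact h.longest_le
    · dsimp only; linarith
    · exact hmul
    · exact h.rest_sum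
    · exact h.card_le
    · exact hsum
    · intro z hz
      rcases List.mem_cons.1 hz with rfl | hz
      · exact h.leader_mem hp'
      · exact h.rounded_mem z hz
    · exact fun _ => h.leader_mem hp'
    · intro z hz
      rcases List.mem_cons.1 hz with rfl | hz
      · exact ⟨hlead, h.leader_seen hp'⟩
      · exact h.kept_spec z hz
    · exact fun _ => h.leader_seen hp'
    · exact .cons (h.leader_le y (by simp)) h.dominated
    · have e := h.sizes_perm
      rw [List.map_cons]
      refine .trans ?_ (e.cons x.1)
      rw [List.cons_append, List.cons_append]
      refine .trans ?_ ((List.perm_middle.symm).cons x.1)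
      refine .trans ?_ (.swap _ _ _)
      refine .cons y ?_
      rw [← List.append_assoc, ← List.append_assoc]
      exact List.perm_middle
    · have := h.old_length
      simp at this
      omega
    · have := h.new_length
      simp
      omega
    · exact fun z hz => h.leader_le z (by simp [hz])
    · exact h.items_perm.cons x
  · have hp' : p = N := by
      have : ¬ p + 1 ≤ N := by exact_mod_cast hp
      have := h.position_le
      omega
    subst hp'
    have hold : old = [] := by
      have := h.old_length
      exact List.eq_nil_of_length_eq_zero (by omega)
    -- The group had load below `1` before this item of size at most `1`, and all its `p + 1` items
    -- are at least `x.1`.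
    have hle : ((p : K) + 1) * x.1 ≤ 2 := by
      have := hmul x.1 (by simpa using hx)
      push_cast at this
      linarith
    refine ⟨p + 1, p + 1, k, M, old, x.1 :: new, Z, ?_⟩
    constructor
    · simp
    · simp
    · exact le_rfl
    -- Items of size at least `1 / n` with total at most `2` number at most `2 * n`.
    · have h2 : ((p + 1 : ℕ) : K) ≤ (2 * n : ℕ) := by
        push_cast
        have hn0 : (0 : K) ≤ n := Nat.cast_nonneg n
        have hp0 : (0 : K) ≤ (p : K) + 1 := by positivity
        calc (p : K) + 1 ≤ (p + 1) * (n * x.1) := le_mul_of_one_le_right hp0 hn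
          _ = n * ((p + 1) * x.1) := by ring
          _ ≤ n * 2 := by gcongr
          _ = 2 * n := by ring
      exact_mod_cast h2
    · dsimp only; linarith
    · exact hmul
    · have := h.rest_sum
      rw [List.map_cons, List.sum_cons, Finset.sum_range_succ]
      have h3 : x.1 ≤ 2 * ((p : K) + 1)⁻¹ := by
        rw [← div_eq_mul_inv, le_div_iff₀ (by positivity)]
        linarith
      linarith
    · exact h.card_le
    · exact hsum
    · exact h.rounded_mem
    · simp
    · exact h.kept_spec
    · simp
    · exact h.dominated
    · have e := h.sizes_perm
      subst hold
      rw [List.map_cons]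
      exact List.perm_middle.trans (by simpa using e)
    · simp [hold]
    · simpa using h.new_length
    · simp [hold]
    · exact List.perm_middle.trans (h.items_perm.cons x)

theorem group_inv {n : ℕ} (l : List (K × K)) (hl : ∀ x ∈ l, 0 ≤ x.1 ∧ x.1 ≤ 1 ∧ 1 ≤ n * x.1)
    (hs : l.Pairwise fun a b => b.1 ≤ a.1) :
    ∃ p N k M old new Z, GroupInv n l.reverse (l.reverse.map Prod.fst) (group l) p N k M old new
      Z := by
  induction l using List.reverseRecOn with
  | nil =>
    refine ⟨0, 0, 0, [], [], [], ∅, ?_⟩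
    constructor <;> simp [group]
  | append_singleton l x ih =>
    rw [List.pairwise_append] at hs
    obtain ⟨p, N, k, M, old, new, Z, h⟩ := ih (fun y hy => hl y (by simp [hy])) hs.1
    have hx : ∀ y ∈ l.reverse, x.1 ≤ y.1 := fun y hy => hs.2.2 y (by simpa using hy) x (by simp)
    obtain ⟨p, k, old, new, Z, hg, h⟩ := h.openGroup hx
    obtain ⟨h0, h1, hn⟩ := hl x (by simp)
    have := h.putItem hg hx h0 h1 hn
    simpa [group, groupStep] using this

/-- The rounded sizes are dominated by the sizes, there are few of them, and the items that are
not kept have a small total size. -/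
theorem group_spec {n : ℕ} {l : List (K × K)} (hl : ∀ x ∈ l, 0 ≤ x.1 ∧ x.1 ≤ 1 ∧ 1 ≤ n * x.1)
    (hs : l.Pairwise fun a b => b.1 ≤ a.1) {kept : List (K × K × K)} {rest : List (K × K)}
    (h : (group l).2 = (kept, rest)) :
    (kept.map Prod.snd ++ rest).Perm l ∧
    (∀ x ∈ kept, x.2.1 ≤ x.1 ∧ x.1 ∈ l.map Prod.fst) ∧
    (∃ M R, List.Forall₂ (· ≤ ·) (kept.map Prod.fst) M ∧ (M ++ R).Perm (l.map Prod.fst)) ∧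
    (((kept.map Prod.fst).toFinset.card : ℕ) : K) ≤ (l.map Prod.fst).sum ∧
    (rest.map Prod.fst).sum ≤ 2 * ∑ i ∈ Finset.range (2 * n), ((i : K) + 1)⁻¹ := by
  obtain ⟨p, N, k, M, old, new, Z, inv⟩ := group_inv l hl hs
  have hr := List.reverse_perm l
  have hrm := hr.map Prod.fst
  obtain ⟨h1, h2⟩ := Prod.ext_iff.1 h
  dsimp only at h1 h2
  subst h1 h2
  refine ⟨inv.items_perm.trans hr, fun x hx => ?_, ⟨M, old ++ new, inv.dominated,
    inv.sizes_perm.trans hrm⟩, ?_, inv.rest_sum.trans ?_⟩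
  · exact ⟨(inv.kept_spec x hx).1, hrm.subset (inv.kept_spec x hx).2⟩
  · have hZ : ((group l).2.1.map Prod.fst).toFinset ⊆ Z := by
      intro z hz
      rw [List.mem_toFinset, List.mem_map] at hz
      obtain ⟨x, hx, rfl⟩ := hz
      exact inv.rounded_mem x hx
    have hk : ((((group l).2.1.map Prod.fst).toFinset.card : ℕ) : K) ≤ k := by
      exact_mod_cast (Finset.card_le_card hZ).trans inv.card_le
    have := inv.complete_le
    have := inv.nonneg
    rw [hrm.sum_eq] at *
    linarith
  · gcongr
    exact inv.longest_le

end Correctness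

/-! ### The value of the relaxation -/

section Relaxation

variable {m m' : ℕ}

/-- Solutions may be given as families in which a pattern is repeated; equal patterns are merged by
adding their weights. -/
theorem sum_mem_fractionalValues {s : Fin m → ℝ} {ι : Type*} (J : Finset ι)
    (q : ι → Fin m → ℕ) (w : ι → ℝ) (hw : ∀ j ∈ J, 0 ≤ w j) (hq : ∀ j ∈ J, IsPattern s (q j))
    (h1 : ∀ i, ∑ j ∈ J, w j * (q j i : ℝ) = 1) : ∑ j ∈ J, w j ∈ fractionalValues s := by
  classical
  have key : ∀ g : (Fin m → ℕ) → ℝ,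
      ∑ p ∈ (∑ j ∈ J, Finsupp.single (q j) (w j)).support,
        (∑ j ∈ J, Finsupp.single (q j) (w j)) p * g p = ∑ j ∈ J, w j * g (q j) := by
    intro g
    have := Finsupp.sum_finsetSum_index (s := J) (g := fun j => Finsupp.single (q j) (w j))
      (h := fun p a => a * g p) (by simp) (fun _ _ _ => by ring)
    rw [Finsupp.sum] at this
    rw [← this]
    exact Finset.sum_congr rfl fun j _ => by rw [Finsupp.sum_single_index (by simp)]
  refine ⟨∑ j ∈ J, Finsupp.single (q j) (w j), fun p => ?_, fun p hp => ?_, fun i => ?_, ?_⟩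
  · rw [Finsupp.finsetSum_apply]
    refine Finset.sum_nonneg fun j hj => ?_
    rw [Finsupp.single_apply]
    split_ifs
    exacts [hw j hj, le_rfl]
  · have := Finsupp.support_finsetSum hp
    simp only [Finset.mem_biUnion] at this
    obtain ⟨j, hj, hp⟩ := this
    have := Finsupp.support_single_subset hp
    rw [Finset.mem_singleton] at this
    exact this ▸ hq j hj
  · rw [key fun p => (p i : ℝ)]
    exact h1 i
  · simpa using (key fun _ => 1).symm

theorem fractionalValues_nonempty {s : Fin m → ℝ} (hs : ∀ i, s i ≤ 1) :
    (fractionalValues s).Nonempty := by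
  refine ⟨_, sum_mem_fractionalValues (s := s) Finset.univ (fun i => Pi.single i 1) (fun _ => 1)
    (by simp) (fun j _ => ?_) (fun i => ?_)⟩
  · rw [IsPattern, Finset.sum_eq_single j] <;> simp +contextual [hs]
  · rw [Finset.sum_eq_single i] <;> simp +contextual [eq_comm]

theorem nonneg_of_mem_fractionalValues {s : Fin m → ℝ} {v : ℝ} (h : v ∈ fractionalValues s) :
    0 ≤ v := by
  obtain ⟨x, h0, _, _, rfl⟩ := h
  exact Finset.sum_nonneg fun p _ => h0 p

theorem bddBelow_fractionalValues (s : Fin m → ℝ) : BddBelow (fractionalValues s) :=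
  ⟨0, fun _ => nonneg_of_mem_fractionalValues⟩

/-- Volume bound: weighting the pattern inequalities by `x` and exchanging the sums gives the total
size on the left. -/
theorem sum_le_optF {s : Fin m → ℝ} (hs : ∀ i, s i ≤ 1) : ∑ i, s i ≤ optF s := by
  refine le_csInf (fractionalValues_nonempty hs) ?_
  rintro _ ⟨x, h0, hp, h1, rfl⟩
  calc ∑ i, s i = ∑ i, (∑ p ∈ x.support, x p * (p i : ℝ)) * s i := by simp [h1]
    _ = ∑ p ∈ x.support, x p * ∑ i, (p i : ℝ) * s i := by
      simp_rw [Finset.sum_mul, Finset.mul_sum]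
      rw [Finset.sum_comm]
      simp_rw [mul_assoc]
    _ ≤ ∑ p ∈ x.support, x p := by
      refine Finset.sum_le_sum fun p hp' => ?_
      exact mul_le_of_le_one_right (h0 p) (hp p hp')

/-- Each pattern of `s` is pulled back along `φ`. It stays a pattern since the sizes do not increase
and the omitted ones are nonnegative; different patterns may acquire the same pullback. -/
theorem optF_le_of_injective {s : Fin m → ℝ} {r : Fin m' → ℝ} (hs : ∀ i, 0 ≤ s i ∧ s i ≤ 1)
    (φ : Fin m' → Fin m) (hφ : Function.Injective φ) (h : ∀ i, r i ≤ s (φ i)) :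
    optF r ≤ optF s := by
  refine le_csInf (fractionalValues_nonempty fun i => (hs i).2) ?_
  rintro _ ⟨x, h0, hp, h1, rfl⟩
  refine csInf_le (bddBelow_fractionalValues r) (sum_mem_fractionalValues x.support
    (fun p i => p (φ i)) x (fun p _ => h0 p) (fun p hp' => ?_) (fun i => h1 (φ i)))
  calc ∑ i, (p (φ i) : ℝ) * r i ≤ ∑ i, (p (φ i) : ℝ) * s (φ i) := by
        gcongr with i; exact h i
    _ = ∑ j ∈ Finset.univ.map ⟨φ, hφ⟩, (p j : ℝ) * s j := by simp
    _ ≤ ∑ j, (p j : ℝ) * s j := Finset.sum_le_sum_of_subset_of_nonneg (Finset.subset_univ _)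
      fun j _ _ => mul_nonneg (by positivity) (hs j).1
    _ ≤ 1 := hp p hp'

theorem optF_fin_zero (s : Fin 0 → ℝ) : optF s = 0 := by
  have h0 : (0 : ℝ) ∈ fractionalValues s := by
    simpa using sum_mem_fractionalValues (s := s) (∅ : Finset ℕ) (fun _ => 0) (fun _ => 0)
      (by simp) (by simp) (fun i => i.elim0)
  have := sum_le_optF (s := s) fun i => i.elim0
  exact le_antisymm (csInf_le (bddBelow_fractionalValues s) h0) (by simpa using this)

theorem exists_perm_of_perm_map {α β : Type*} {f : α → β} {l : List β} {T : List α}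
    (h : l.Perm (T.map f)) : ∃ L : List α, l = L.map f ∧ L.Perm T := by
  have e := congrFun₂ (List.eq_map_comp_perm f) l T
  exact e.mpr h

/-- The permutation of sizes lifts to an ordering `L` of the indices, so the partner of the `i`-th
item has index `L[i]`; injectivity holds because `L` has no duplicates, even when sizes coincide. -/
theorem exists_injective_of_forall₂ {K : Type*} [LE K] {s : Fin m → K} {r : Fin m' → K}
    {M R : List K} (h : List.Forall₂ (· ≤ ·) (List.ofFn r) M) (hp : (M ++ R).Perm (List.ofFn s)) :
    ∃ φ : Fin m' → Fin m, Function.Injective φ ∧ ∀ i, r i ≤ s (φ i) := by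
  rw [List.ofFn_eq_map] at hp
  obtain ⟨L, hL, hLp⟩ := exists_perm_of_perm_map hp
  have hnd : L.Nodup := hLp.nodup_iff.2 (List.nodup_finRange m)
  obtain ⟨hlen, hle⟩ := List.forall₂_iff_get.1 h
  rw [List.length_ofFn] at hlen
  have hlen' : M.length + R.length = L.length := by
    rw [← List.length_append, hL, List.length_map]
  refine ⟨fun i => L[i.1]'(by omega), fun i j hij => ?_, fun i => ?_⟩
  · exact Fin.ext ((hnd.getElem_inj_iff).1 hij)
  · have h1 := hle i (by simp) (by omega)
    have h2 : M[i.1]'(by omega) = s (L[i.1]'(by omega)) := by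
      have : (M ++ R)[i.1]'(by rw [List.length_append]; omega) = s (L[i.1]'(by omega)) := by
        simp [hL]
      rwa [List.getElem_append_left] at this
    simpa [h2] using h1

end Relaxation

/-! ### Correctness of the greedy procedure -/

section Greedy

/-- The labels of the used bins. -/
def labels {K : Type*} [DecidableEq K] (T : List (K × K × K)) : Finset K :=
  (T.map fun e => e.2.2).toFinset

@[simp] theorem labels_cons {K : Type*} [DecidableEq K] (e : K × K × K) (T : List (K × K × K)) :
    labels (e :: T) = insert e.2.2 (labels T) := by
  simp [labels]

variable {K : Type*} [Field K]

/-- The total size of the packed items. -/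
def totalSize (T : List (K × K × K)) : K :=
  (T.map fun e => e.2.1).sum

@[simp] theorem totalSize_cons (e : K × K × K) (T : List (K × K × K)) :
    totalSize (e :: T) = e.2.1 + totalSize T := by
  simp [totalSize]

variable [LinearOrder K]

/-- The total size of the items with label `b`. -/
def binLoad (T : List (K × K × K)) (b : K) : K :=
  (T.map fun e => if e.2.2 = b then e.2.1 else 0).sum

@[simp] theorem binLoad_cons (e : K × K × K) (T : List (K × K × K)) (b : K) :
    binLoad (e :: T) b = (if e.2.2 = b then e.2.1 else 0) + binLoad T b := by
  simp [binLoad]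

theorem load_eq_binLoad (T : List (K × K × K)) (b : K) : load T b = binLoad T b := by
  have h : ∀ (T : List (K × K × K)) (c : K), T.foldl (fun acc e =>
      if e.2.2 ≤ b then if b ≤ e.2.2 then acc + e.2.1 else acc else acc) c = c + binLoad T b := by
    intro T
    induction T with
    | nil => simp [binLoad]
    | cons e T ih =>
      intro c
      rw [List.foldl_cons, ih, binLoad_cons]
      by_cases he : e.2.2 = b
      · simp [he, add_assoc]
      · rw [if_neg he, zero_add]
        split_ifs with h1 h2
        · exact absurd (le_antisymm h1 h2) he
        · rfl
        · rfl
  simpa [load] using h T 0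

theorem sum_binLoad {T : List (K × K × K)} {F : Finset K} (h : labels T ⊆ F) :
    ∑ b ∈ F, binLoad T b = totalSize T := by
  induction T with
  | nil => simp [binLoad, totalSize]
  | cons e T ih =>
    rw [labels_cons, Finset.insert_subset_iff] at h
    simp [Finset.sum_add_distrib, ih h.2, h.1]

theorem binLoad_eq_zero {T : List (K × K × K)} {b : K} (h : b ∉ labels T) : binLoad T b = 0 := by
  induction T with
  | nil => simp [binLoad]
  | cons e T ih =>
    rw [labels_cons, Finset.mem_insert, not_or] at h
    rw [binLoad_cons, ih h.2, if_neg (Ne.symm h.1), add_zero]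

/-- The any-fit property: a fresh bin is chosen only when the item fits into no used bin. -/
theorem chooseLabel_spec (T : List (K × K × K)) (z : K) :
    (chooseLabel T z ∈ labels T ∧ binLoad T (chooseLabel T z) + z ≤ 1) ∨
      (chooseLabel T z = freshLabel T ∧ ∀ b ∈ labels T, 1 < binLoad T b + z) := by
  have h : ∀ (S : List (K × K × K)) (c r : K), S.foldl (fun c e =>
      if load T e.2.2 + z ≤ 1 then e.2.2 else c) c = r →
      (r ∈ labels S ∧ binLoad T r + z ≤ 1) ∨ (r = c ∧ ∀ b ∈ labels S, 1 < binLoad T b + z) := by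
    intro S
    induction S with
    | nil => rintro c _ rfl; exact .inr ⟨rfl, by simp [labels]⟩
    | cons e S ih =>
      intro c r hr
      rw [List.foldl_cons, load_eq_binLoad] at hr
      rw [labels_cons]
      split_ifs at hr with he
      · rcases ih _ _ hr with h | ⟨rfl, h⟩
        · exact .inl ⟨Finset.mem_insert_of_mem h.1, h.2⟩
        · exact .inl ⟨Finset.mem_insert_self _ _, he⟩
      · rcases ih _ _ hr with h | ⟨rfl, h⟩
        · exact .inl ⟨Finset.mem_insert_of_mem h.1, h.2⟩
        · exact .inr ⟨rfl, by simpa [not_le.1 he] using h⟩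
  exact h T _ _ rfl

theorem foldl_place_perm (l : List (K × K)) (T : List (K × K × K)) :
    ((l.foldl place T).map fun e => (e.2.1, e.1)).Perm (l ++ T.map fun e => (e.2.1, e.1)) := by
  induction l generalizing T with
  | nil => simp
  | cons x l ih => exact (ih _).trans (by simp [place])

theorem totalSize_foldl_place (l : List (K × K)) (T : List (K × K × K)) :
    totalSize (l.foldl place T) = (l.map Prod.fst).sum + totalSize T := by
  induction l generalizing T with
  | nil => simp
  | cons x l ih => simp [ih, place]; ring

variable [IsStrictOrderedRing K]

/-- A packing of items of nonnegative sizes whose labels are natural numbers. -/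
structure ValidPacking (T : List (K × K × K)) : Prop where
  natCast : ∀ b ∈ labels T, ∃ n : ℕ, b = n
  load_le : ∀ b, binLoad T b ≤ 1
  nonneg : ∀ e ∈ T, 0 ≤ e.2.1

/-- One plus the sum of nonnegative labels exceeds each of them, and it is again a natural number.
-/
theorem freshLabel_spec {T : List (K × K × K)} (hT : ∀ b ∈ labels T, ∃ n : ℕ, b = n) :
    (∃ n : ℕ, freshLabel T = n) ∧ freshLabel T ∉ labels T := by
  have h : ∀ (S : List (K × K × K)) (c : ℕ), (∀ b ∈ labels S, ∃ n : ℕ, b = n) →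
      ∃ n : ℕ, S.foldl (fun acc e => acc + e.2.2) (c : K) = n ∧ (c : K) ≤ n ∧
        ∀ b ∈ labels S, c + b ≤ n := by
    intro S
    induction S with
    | nil => exact fun c _ => ⟨c, by simp [labels]⟩
    | cons e S ih =>
      intro c hS
      obtain ⟨k, hk⟩ := hS e.2.2 (by simp)
      obtain ⟨n, h1, h2, h3⟩ := ih (c + k) fun b hb => hS b (by simp [hb])
      push_cast at h1 h2 h3
      have hk0 : (0 : K) ≤ k := Nat.cast_nonneg k
      refine ⟨n, by rw [List.foldl_cons, hk, h1], by linarith, fun b hb => ?_⟩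
      rw [labels_cons, Finset.mem_insert] at hb
      rcases hb with rfl | hb
      · rw [hk]; exact h2
      · linarith [h3 b hb]
  obtain ⟨n, h1, -, h3⟩ := h T 1 hT
  rw [Nat.cast_one] at h1 h3
  refine ⟨⟨n, h1⟩, fun hb => ?_⟩
  have := h3 _ hb
  rw [freshLabel, h1] at this
  linarith

namespace ValidPacking

variable {T : List (K × K × K)}

theorem binLoad_nonneg (hT : ValidPacking T) (b : K) : 0 ≤ binLoad T b := by
  refine List.sum_nonneg fun y hy => ?_
  obtain ⟨e, he, rfl⟩ := List.mem_map.1 hy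
  split_ifs
  exacts [hT.nonneg e he, le_rfl]

theorem place (hT : ValidPacking T) {x : K × K} (h0 : 0 ≤ x.1) (h1 : x.1 ≤ 1) :
    ValidPacking (place T x) := by
  have hf := freshLabel_spec hT.natCast
  refine ⟨fun b hb => ?_, fun b => ?_, fun e he => ?_⟩
  · rw [BinPacking.place, labels_cons, Finset.mem_insert] at hb
    rcases hb with rfl | hb
    · rcases chooseLabel_spec T x.1 with h | h
      · exact hT.natCast _ h.1
      · exact h.1 ▸ hf.1
    · exact hT.natCast b hb
  · rw [BinPacking.place, binLoad_cons]
    split_ifs with hb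
    · dsimp only at hb ⊢
      subst hb
      rcases chooseLabel_spec T x.1 with h | h
      · linarith [h.2]
      · rw [h.1, binLoad_eq_zero hf.2]
        linarith
    · rw [zero_add]
      exact hT.load_le b
  · rcases List.mem_cons.1 he with rfl | he
    · exact h0
    · exact hT.nonneg e he

theorem foldl_place (hT : ValidPacking T) {l : List (K × K)} (hl : ∀ x ∈ l, 0 ≤ x.1 ∧ x.1 ≤ 1) :
    ValidPacking (l.foldl BinPacking.place T) := by
  induction l generalizing T with
  | nil => exact hT
  | cons x l ih =>
    exact ih (hT.place (hl x (by simp)).1 (hl x (by simp)).2) fun y hy => hl y (by simp [hy])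

end ValidPacking

/-- Among the new bins `H` at most one, `c`, is not more than half full. If an item of size at most
`1/2` opens a bin, all older bins are more than half full and the new bin becomes the exception; a
larger item fills more than half of its own bin. -/
theorem exists_new_bins {l : List (K × K)} (hl : ∀ x ∈ l, 0 ≤ x.1 ∧ x.1 ≤ 1)
    {T : List (K × K × K)} (hT : ValidPacking T) :
    ∃ (H : Finset K) (c : K), H ⊆ labels (l.foldl place T) ∧
      labels (l.foldl place T) ⊆ labels T ∪ H ∧
      ∑ b ∈ H, binLoad (l.foldl place T) b ≤ (l.map Prod.fst).sum ∧
      ∀ b ∈ H, b ≠ c → 1 / 2 < binLoad (l.foldl place T) b := by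
  induction l using List.reverseRecOn with
  | nil => exact ⟨∅, 0, by simp⟩
  | append_singleton l x ih =>
    have hl' : ∀ y ∈ l, 0 ≤ y.1 ∧ y.1 ≤ 1 := fun y hy => hl y (by simp [hy])
    obtain ⟨H, c, h1, h2, h3, h4⟩ := ih hl'
    have hx := (hl x (by simp)).1
    have hV := hT.foldl_place hl'
    rw [List.foldl_append, List.foldl_cons, List.foldl_nil]
    generalize l.foldl place T = S at *
    have hS := (hV.place hx (hl x (by simp)).2)
    have hmono : ∀ b, binLoad S b ≤ binLoad (place S x) b := by
      intro b
      rw [place, binLoad_cons, le_add_iff_nonneg_left]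
      split_ifs
      exacts [hx, le_rfl]
    have hsum : ∀ F : Finset K, ∑ b ∈ F, binLoad (place S x) b ≤ x.1 + ∑ b ∈ F, binLoad S b := by
      intro F
      simp only [place, binLoad_cons, Finset.sum_add_distrib, Finset.sum_ite_eq]
      gcongr
      split_ifs
      exacts [le_rfl, hx]
    have hlab : labels (place S x) = insert (chooseLabel S x.1) (labels S) := labels_cons _ _
    rw [List.map_append, List.sum_append]
    simp only [List.map_cons, List.map_nil, List.sum_cons, List.sum_nil, add_zero]
    rcases chooseLabel_spec S x.1 with h | ⟨h, hfull⟩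
    · rw [Finset.insert_eq_self.2 h.1] at hlab
      rw [hlab]
      exact ⟨H, c, h1, h2, by linarith [hsum H], fun b hb hbc => (h4 b hb hbc).trans_le (hmono b)⟩
    · have hf := (freshLabel_spec hV.natCast).2
      rw [h] at hlab
      have hsub : insert (freshLabel S) H ⊆ labels (place S x) := by
        rw [hlab]; exact Finset.insert_subset_insert _ h1
      have hsup : labels (place S x) ⊆ labels T ∪ insert (freshLabel S) H := by
        rw [hlab, Finset.union_insert]; exact Finset.insert_subset_insert _ h2
      have hsum' : ∑ b ∈ insert (freshLabel S) H, binLoad (place S x) b ≤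
          (l.map Prod.fst).sum + x.1 := by
        refine (hsum _).trans ?_
        rw [Finset.sum_insert fun hH => hf (h1 hH), binLoad_eq_zero hf]
        linarith
      rcases le_or_gt x.1 (1 / 2) with hx2 | hx2
      · refine ⟨_, freshLabel S, hsub, hsup, hsum', fun b hb hbc => ?_⟩
        have hb := h1 (Finset.mem_of_mem_insert_of_ne hb hbc)
        linarith [hfull b hb, hmono b]
      · refine ⟨_, c, hsub, hsup, hsum', fun b hb hbc => ?_⟩
        rcases Finset.mem_insert.1 hb with rfl | hb
        · rw [place, binLoad_cons, h, if_pos rfl, binLoad_eq_zero hf, add_zero]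
          exact hx2
        · exact (h4 b hb hbc).trans_le (hmono b)

/-- The number of bins that are opened is bounded in terms of the total size of the new items. -/
theorem card_labels_foldl_place_le {l : List (K × K)} (hl : ∀ x ∈ l, 0 ≤ x.1 ∧ x.1 ≤ 1)
    {T : List (K × K × K)} (hT : ValidPacking T) :
    ((labels (l.foldl place T)).card : K) ≤ (labels T).card + 2 * (l.map Prod.fst).sum + 1 := by
  obtain ⟨H, c, -, h2, h3, h4⟩ := exists_new_bins hl hT
  have hV := hT.foldl_place hl
  have h5 : ((H.erase c).card : K) * (1 / 2) ≤ ∑ b ∈ H, binLoad (l.foldl place T) b := by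
    rw [← nsmul_eq_mul]
    refine (Finset.card_nsmul_le_sum _ _ _ fun b hb => ?_).trans
      (Finset.sum_le_sum_of_subset_of_nonneg (Finset.erase_subset c H)
        fun b _ _ => hV.binLoad_nonneg b)
    exact (h4 b (Finset.mem_of_mem_erase hb) (Finset.ne_of_mem_erase hb)).le
  have h6 : (H.card : K) ≤ (H.erase c).card + 1 := by
    exact_mod_cast Nat.sub_le_iff_le_add.1 Finset.pred_card_le_card_erase
  have h7 : ((labels (l.foldl place T)).card : K) ≤ (labels T).card + H.card := by
    exact_mod_cast (Finset.card_le_card h2).trans (Finset.card_union_le _ _)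
  linarith

/-- If small items open a bin, then all but one bin are almost full. -/
theorem labels_foldl_place_small {δ : K} (hδ : δ ≤ 1) {l : List (K × K)}
    (hl : ∀ x ∈ l, 0 ≤ x.1 ∧ x.1 ≤ δ) {T : List (K × K × K)} (hT : ValidPacking T) :
    labels (l.foldl place T) = labels T ∨
      ((labels (l.foldl place T)).card - 1) * (1 - δ) ≤ totalSize (l.foldl place T) := by
  induction l generalizing T with
  | nil => exact .inl rfl
  | cons x l ih =>
    obtain ⟨hx0, hxδ⟩ := hl x (by simp)
    rw [List.foldl_cons]
    have hlab : labels (place T x) = insert (chooseLabel T x.1) (labels T) := labels_cons _ _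
    -- Either a later item gives the second alternative, or no later item opens a bin. In the latter
    -- case, if `x` opens one, all older bins have load above `1 - δ`, and the bin of `x` is the one
    -- subtracted.
    rcases ih (fun y hy => hl y (by simp [hy])) (hT.place hx0 (hxδ.trans hδ)) with h | h
    · rcases chooseLabel_spec T x.1 with h' | ⟨h', hfull⟩
      · left
        rw [h, hlab, Finset.insert_eq_self.2 h'.1]
      · right
        rw [h, hlab, h', Finset.card_insert_of_notMem (freshLabel_spec hT.natCast).2]
        push_cast
        rw [add_sub_cancel_right, totalSize_foldl_place, place, totalSize_cons,
          ← sum_binLoad subset_rfl, ← nsmul_eq_mul]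
        have h8 : (labels T).card • (1 - δ) ≤ ∑ b ∈ labels T, binLoad T b :=
          Finset.card_nsmul_le_sum _ _ _ fun b hb => by linarith [hfull b hb]
        have h9 : 0 ≤ (l.map Prod.fst).sum := List.sum_nonneg fun y hy => by
          obtain ⟨z, hz, rfl⟩ := List.mem_map.1 hy
          exact (hl z (by simp [hz])).1
        dsimp only
        linarith
    · exact .inr h

end Greedy

/-! ### Correctness of the algorithm -/

theorem labels_perm {K : Type*} [DecidableEq K] {T T' : List (K × K × K)} (h : T.Perm T') : labels T = labels T' :=
  List.toFinset_eq_of_perm _ _ (h.map _)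

theorem mem_labels_ofFn {K : Type*} [DecidableEq K] {m : ℕ} {x s c : Fin m → K} {b : K} :
    b ∈ labels (List.ofFn fun i => (x i, s i, c i)) ↔ ∃ i, c i = b := by
  simp [labels, List.mem_ofFn]

section Complete

variable {K : Type*} [Field K]

theorem attach_ofFn (k : List (K × K × K)) (b : Fin k.length → K) :
    attach k (List.ofFn b) =
      (List.ofFn fun i => ((k.get i).2.2, (k.get i).2.1, b i)).reverse := by
  have h : ∀ (l : List (K × K × K)) (a : List K) (r : List (K × K × K)), a.length = l.length →
      (l.foldl (fun st x => (st.1.tail, (x.2.2, x.2.1, st.1.headD 0) :: st.2)) (a, r)).2 =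
        (List.zipWith (fun x b => (x.2.2, x.2.1, b)) l a).reverse ++ r := by
    intro l
    induction l with
    | nil => simp
    | cons x l ih =>
      rintro (_ | ⟨c, a⟩) r ha
      · simp at ha
      · simp only [List.length_cons, add_left_inj] at ha
        simpa using ih a ((x.2.2, x.2.1, c) :: r) ha
  have h' := h k (List.ofFn b) [] (by simp)
  rw [attach, h', List.append_nil]
  congr 1
  apply List.ext_getElem <;> simp

variable [LinearOrder K]

theorem binLoad_perm {T T' : List (K × K × K)} (h : T.Perm T') (b : K) :
    binLoad T b = binLoad T' b :=
  (h.map _).sum_eq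

theorem binLoad_ofFn {m : ℕ} (x s c : Fin m → K) (b : K) :
    binLoad (List.ofFn fun i => (x i, s i, c i)) b = ∑ i, if c i = b then s i else 0 := by
  simp [binLoad, List.map_ofFn, List.sum_ofFn]

variable [IsStrictOrderedRing K]

/-- Replacing rounded sizes by the true, smaller ones keeps every bin within capacity. -/
theorem attach_spec {k : List (K × K × K)} (hk : ∀ x ∈ k, 0 ≤ x.2.1 ∧ x.2.1 ≤ x.1)
    {a : Fin k.length → ℕ} (ha : IsPacking (fun i => (k.get i).1) a) :
    ValidPacking (attach k (List.ofFn fun i => (a i : K))) ∧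
      (labels (attach k (List.ofFn fun i => (a i : K)))).card ≤ numBins a ∧
      ((attach k (List.ofFn fun i => (a i : K))).map fun e => (e.2.1, e.1)).Perm
        (k.map Prod.snd) := by
  rw [attach_ofFn]
  have hp := List.reverse_perm
    (List.ofFn fun i => ((k.get i).2.2, (k.get i).2.1, (a i : K)))
  have hlab := labels_perm hp
  refine ⟨⟨fun b hb => ?_, fun b => ?_, fun e he => ?_⟩, ?_, (hp.map _).trans (.of_eq ?_)⟩
  · rw [hlab, mem_labels_ofFn] at hb
    obtain ⟨i, rfl⟩ := hb
    exact ⟨_, rfl⟩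
  · rw [binLoad_perm hp, binLoad_ofFn]
    by_cases hb : ∃ i, (a i : K) = b
    · obtain ⟨j, rfl⟩ := hb
      refine le_trans ?_ (ha (a j))
      rw [Finset.sum_filter]
      refine Finset.sum_le_sum fun i _ => ?_
      simp only [Nat.cast_inj]
      split_ifs
      exacts [(hk _ (List.get_mem _ _)).2, le_rfl]
    · push Not at hb
      simp [hb]
  · rw [List.mem_reverse, List.mem_ofFn] at he
    obtain ⟨i, rfl⟩ := he
    exact (hk _ (List.get_mem _ _)).1
  · have : labels (List.ofFn fun i => ((k.get i).2.2, (k.get i).2.1, (a i : K))) ⊆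
        (Finset.univ.image a).image Nat.cast := by
      intro b hb
      rw [mem_labels_ofFn] at hb
      obtain ⟨i, rfl⟩ := hb
      simp
    rw [hlab]
    exact (Finset.card_le_card this).trans Finset.card_image_le
  · apply List.ext_getElem <;> simp

/-- The keys are the distinct indices, so the sorted list is unique: it must be the list in index
order, reversed. -/
theorem labelsInOrder_spec {m : ℕ} {s : Fin m → K} {T : List (K × K × K)} (hT : ValidPacking T)
    (h : (T.map fun e => (e.2.1, e.1)).Perm (List.ofFn fun i => (s i, ((i : ℕ) : K)))) :
    ∃ a : Fin m → ℕ, labelsInOrder T = List.ofFn (fun i => (a i : K)) ∧ IsPacking s a ∧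
      numBins a ≤ (labels T).card := by
  obtain ⟨L, hL, hLT⟩ := exists_perm_of_perm_map h.symm
  have hlen : L.length = m := by simpa using (congrArg List.length hL).symm
  subst hlen
  have hget : ∀ i : Fin L.length, (L[i].2.1, L[i].1) = (s i, ((i : ℕ) : K)) := by
    intro i
    have : (List.ofFn fun i => (s i, ((i : ℕ) : K)))[i.1]'(by simp) =
      (L.map fun e => (e.2.1, e.1))[i.1]'(by simp) := by simp only [hL]
    simpa using this.symm
  have hnat : ∀ i : Fin L.length, ∃ n : ℕ, L[i].2.2 = n := fun i =>
    hT.natCast _ (labels_perm hLT ▸ List.mem_toFinset.2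
      (List.mem_map_of_mem (List.getElem_mem i.2)))
  choose a ha using hnat
  have hLa : L = List.ofFn fun i => (((i : ℕ) : K), s i, (a i : K)) := by
    apply List.ext_getElem
    · simp
    · intro i h1 h2
      have e1 := hget ⟨i, h1⟩
      have e2 := ha ⟨i, h1⟩
      simp only [Fin.getElem_fin, Prod.mk.injEq] at e1 e2
      rw [List.getElem_ofFn]
      ext
      exacts [e1.2, e1.1, e2]
  have hET : (List.ofFn fun i => (((i : ℕ) : K), s i, (a i : K))).Perm T := by
    rw [← hLa]; exact hLT
  have hload : ∀ b, binLoad T b = ∑ i, if (a i : K) = b then s i else 0 := by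
    intro b
    rw [← binLoad_perm hET]
    exact binLoad_ofFn _ _ _ b
  have hlab : (Finset.univ.image a).image (Nat.cast : ℕ → K) ⊆ labels T := by
    intro b hb
    simp only [Finset.mem_image, Finset.mem_univ, true_and, exists_exists_eq_and] at hb
    rw [← labels_perm hET, mem_labels_ofFn]
    exact hb
  have hsort : sortKey T =
      (List.ofFn fun i => (((i : ℕ) : K), s i, (a i : K))).reverse := by
    refine List.Perm.eq_of_pairwise (le := fun a b => b.1 ≤ a.1) ?_ (sortKey_sorted T) ?_
      ((sortKey_perm T).trans (hET.symm.trans (List.reverse_perm _).symm))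
    · intro x y hx hy hxy hyx
      obtain ⟨i, rfl⟩ := List.mem_ofFn.1 (hET.symm.subset ((sortKey_perm T).subset hx))
      obtain ⟨j, rfl⟩ := List.mem_ofFn.1 (List.mem_reverse.1 hy)
      have : (i : ℕ) = j := Nat.cast_injective (R := K) (le_antisymm hyx hxy)
      rw [Fin.ext this]
    · rw [List.pairwise_reverse, List.pairwise_ofFn]
      exact fun i j hij => Nat.cast_le.2 hij.le
  refine ⟨a, ?_, fun b => ?_, ?_⟩
  · rw [labelsInOrder, hsort, List.map_reverse, List.reverse_reverse]
    simp [List.map_ofFn, Function.comp_def]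
  · have := hT.load_le b
    rw [hload] at this
    simpa [Finset.sum_filter] using this
  · rw [numBins, ← Finset.card_image_of_injective _ (Nat.cast_injective (R := K))]
    exact Finset.card_le_card hlab

/-- What the first phase of the algorithm achieves. -/
theorem prepare_spec {m : ℕ} {s : Fin m → K} (hs : ∀ i, 0 ≤ s i ∧ s i ≤ 1)
    {k : List (K × K × K)} {d r : List (K × K)} (h : prepare (List.ofFn s) = ((k, d), r)) :
    ∃ n : ℕ, (n : K) ≤ ∑ i, s i ∧ ∑ i, s i < n + 1 ∧
      (k.map Prod.snd ++ d ++ r).Perm (List.ofFn fun i => (s i, ((i : ℕ) : K))) ∧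
      (∀ x ∈ k, 0 ≤ x.2.1 ∧ x.2.1 ≤ x.1 ∧ 1 ≤ n * x.1 ∧ x.1 ∈ List.ofFn s) ∧
      (k.map Prod.fst).toFinset.card ≤ n ∧
      (∃ φ : Fin k.length → Fin m, Function.Injective φ ∧ ∀ i, (k.get i).1 ≤ s (φ i)) ∧
      (∀ x ∈ d ++ r, 0 ≤ x.1 ∧ x.1 ≤ 1) ∧
      (d.map Prod.fst).sum ≤ 2 * ∑ i ∈ Finset.range (2 * n), ((i : K) + 1)⁻¹ ∧
      ∀ x ∈ r, n * x.1 < 1 := by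
  obtain ⟨h12, rfl⟩ := Prod.ext_iff.1 h
  dsimp only [prepare] at h12 ⊢
  have hmem : ∀ x ∈ List.ofFn s, 0 ≤ x ∧ x ≤ 1 := by
    intro x hx
    obtain ⟨i, rfl⟩ := List.mem_ofFn.1 hx
    exact hs i
  obtain ⟨hn1, hn2⟩ := ticks_length hmem
  obtain ⟨hp, hlarge, hsmall⟩ := split_spec (ticks (List.ofFn s)) (indexed (List.ofFn s))
  generalize (ticks (List.ofFn s)).length = n at *
  rw [List.sum_ofFn] at hn1 hn2
  have hq := hp.trans (indexed_perm s)
  generalize split (ticks (List.ofFn s)) (indexed (List.ofFn s)) = LS at *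
  obtain ⟨L, S⟩ := LS
  dsimp only at *
  have hall : ∀ x ∈ L ++ S, x.1 ∈ List.ofFn s := by
    intro x hx
    obtain ⟨i, rfl⟩ := List.mem_ofFn.1 (hq.subset hx)
    exact List.mem_ofFn.2 ⟨i, rfl⟩
  have hperm := sortKey_perm L
  have hfst : (L.map Prod.fst ++ S.map Prod.fst).Perm (List.ofFn s) := by
    have := hq.map Prod.fst
    rwa [List.map_append, List.map_ofFn] at this
  obtain ⟨g1, g2, ⟨M, R, g3, g4⟩, g5, g6⟩ := group_spec (n := n) (l := sortKey L) (fun x hx => by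
    have hx := hperm.subset hx
    have := hmem _ (hall x (List.mem_append_left _ hx))
    exact ⟨this.1, this.2, hlarge x hx⟩) (sortKey_sorted L) h12
  have g1' := g1.trans hperm
  have hkL : ∀ x ∈ k, x.2 ∈ L := fun x hx =>
    g1'.subset (List.mem_append_left _ (List.mem_map_of_mem hx))
  refine ⟨n, hn1, hn2, (g1'.append_right S).trans hq, fun x hx => ?_, ?_, ?_, fun x hx => ?_, g6,
    hsmall⟩
  · have hx1 := (hperm.map Prod.fst).subset (g2 x hx).2
    obtain ⟨y, hy, hyx⟩ := List.mem_map.1 hx1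
    exact ⟨(hmem _ (hall _ (List.mem_append_left _ (hkL x hx)))).1, (g2 x hx).1,
      hyx ▸ hlarge y hy, hyx ▸ hall y (List.mem_append_left _ hy)⟩
  · have h1 : (L.map Prod.fst).sum ≤ ∑ i, s i := by
      rw [← List.sum_ofFn, ← hfst.sum_eq, List.sum_append, le_add_iff_nonneg_right]
      refine List.sum_nonneg fun y hy => ?_
      obtain ⟨z, hz, rfl⟩ := List.mem_map.1 hy
      exact (hmem _ (hall z (List.mem_append_right _ hz))).1
    rw [(hperm.map Prod.fst).sum_eq] at g5
    -- The number of rounded sizes is an integer at most `σ < n + 1`, hence at most `n`.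
    have : (((k.map Prod.fst).toFinset.card : ℕ) : K) < (n + 1 : ℕ) := by
      push_cast
      linarith
    exact Nat.lt_succ_iff.1 (by exact_mod_cast this)
  · refine exists_injective_of_forall₂ (M := M) (R := R ++ S.map Prod.fst) ?_ ?_
    · convert g3 using 1
      apply List.ext_getElem <;> simp
    · rw [← List.append_assoc]
      exact ((g4.trans (hperm.map Prod.fst)).append_right _).trans hfst
  · refine hmem _ (hall x ?_)
    rcases List.mem_append.1 hx with hx | hx
    · exact List.mem_append_left _ (g1'.subset (List.mem_append_right _ hx))
    · exact List.mem_append_right _ hx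

/-- The alternatives correspond to whether the small items open no bin, where any-fit for `d` is the
only cost, or do open one, where volume bounds the number of bins. -/
theorem complete_spec {m n : ℕ} {s : Fin m → K} {k : List (K × K × K)} {d r : List (K × K)}
    (hn2 : ∑ i, s i < n + 1)
    (hp : (k.map Prod.snd ++ d ++ r).Perm (List.ofFn fun i => (s i, ((i : ℕ) : K))))
    (hk : ∀ x ∈ k, 0 ≤ x.2.1 ∧ x.2.1 ≤ x.1) (hdr : ∀ x ∈ d ++ r, 0 ≤ x.1 ∧ x.1 ≤ 1)
    (hr : ∀ x ∈ r, n * x.1 < 1) {b : Fin k.length → ℕ}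
    (hb : IsPacking (fun i => (k.get i).1) b) :
    ∃ a : Fin m → ℕ,
      labelsInOrder (complete k d r (List.ofFn fun i => (b i : K))) =
        List.ofFn (fun i => (a i : K)) ∧ IsPacking s a ∧
      ((numBins a : K) ≤ numBins b + 2 * (d.map Prod.fst).sum + 6 ∨
        (numBins a : K) ≤ ∑ i, s i + 4) := by
  obtain ⟨v1, c1, p1⟩ := attach_spec hk hb
  unfold complete
  generalize attach k (List.ofFn fun i => (b i : K)) = T1 at *
  have hd' : ∀ x ∈ d, 0 ≤ x.1 ∧ x.1 ≤ 1 := fun x hx => hdr x (List.mem_append_left _ hx)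
  have hr' : ∀ x ∈ r, 0 ≤ x.1 ∧ x.1 ≤ 1 := fun x hx => hdr x (List.mem_append_right _ hx)
  have v2 := v1.foldl_place hd'
  have c2 := card_labels_foldl_place_le hd' v1
  have p2 := foldl_place_perm d T1
  generalize d.foldl place T1 = T2 at *
  have v3 := v2.foldl_place hr'
  have c3 := card_labels_foldl_place_le hr' v2
  have p3 := foldl_place_perm r T2
  have c1' : ((labels T1).card : K) ≤ numBins b := by exact_mod_cast c1
  have hperm : ((r.foldl place T2).map fun e => (e.2.1, e.1)).Perm
      (List.ofFn fun i => (s i, ((i : ℕ) : K))) := by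
    refine p3.trans (.trans ?_ hp)
    refine List.perm_append_comm.trans (.append_right r ?_)
    exact p2.trans (List.perm_append_comm.trans (p1.append_right d))
  have htot : totalSize (r.foldl place T2) = ∑ i, s i := by
    have := (hperm.map Prod.fst).sum_eq
    simpa [List.map_ofFn, List.sum_ofFn, Function.comp_def, totalSize] using this
  have hsmall : (r.map Prod.fst).sum ≤ ∑ i, s i := by
    rw [← htot, totalSize_foldl_place, le_add_iff_nonneg_right]
    refine List.sum_nonneg fun y hy => ?_
    obtain ⟨e, he, rfl⟩ := List.mem_map.1 hy
    exact v2.nonneg e he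
  have c4 := fun δ h1 h2 => labels_foldl_place_small (δ := δ) (l := r) h1 h2 v2
  rw [htot] at c4
  obtain ⟨a, ha, hpack, hcard⟩ := labelsInOrder_spec v3 hperm
  refine ⟨a, ha, hpack, ?_⟩
  have hcard' : (numBins a : K) ≤ (labels (r.foldl place T2)).card := by exact_mod_cast hcard
  -- For `n < 2` the threshold `1 / n` leaves no slack, but the total size is below `2`; so the
  -- small items open at most `5` bins, and `6` includes the extra bin for `d`.
  rcases Nat.lt_or_ge n 2 with hn | hn
  · left
    have : (n : K) + 1 ≤ 2 := by exact_mod_cast hn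
    linarith
  · have hn' : (2 : K) ≤ n := by exact_mod_cast hn
    have hn0 : (0 : K) < n := by linarith
    rcases c4 (n : K)⁻¹ (inv_le_one_of_one_le₀ (by linarith)) (fun x hx =>
      ⟨(hr' x hx).1, by rw [inv_eq_one_div, le_div_iff₀ hn0]; linarith [hr x hx]⟩) with h | h
    · left
      rw [h] at hcard'
      linarith
    · right
      set B := ((labels (r.foldl place T2)).card : K)
      have e : (B - 1) * (1 - (n : K)⁻¹) * n = (B - 1) * (n - 1) := by
        field_simp
      -- Dividing by `n - 1` gives `B - 1 ≤ σ + σ / (n - 1)`, and `σ < n + 1` with `n ≥ 2` makes the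
      -- last term at most `3`.
      have h' : (B - 1) * (n - 1) ≤ (∑ i, s i) * n := by
        rw [← e]; gcongr
      by_contra hcon
      have hB : ∑ i, s i + 3 < B - 1 := by linarith
      have : (∑ i, s i + 3) * ((n : K) - 1) < (B - 1) * (n - 1) := by
        apply mul_lt_mul_of_pos_right hB; linarith
      nlinarith

end Complete

/-! ### The main theorem -/

/-- The first alternative costs at most `10 + 4 log (2n)` bins beyond `O + f O`. Constants are
absorbed since `log (O + 2) ≥ log 2 > 0.69`, for which `30` is ample. The second alternative needs
`f O ≥ 0`. -/
theorem numBins_bound {f : ℝ → ℝ} (hf : MonotoneOn f (Set.Ici 0)) (hf0 : 0 ≤ f 0) {n : ℕ}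
    {σ O O' B B' d : ℝ} (hn : n ≤ σ) (hσ : σ ≤ O) (hO' : O' ≤ O) (hB' : B' ≤ O' + f n)
    (hd : d ≤ 2 * ∑ i ∈ Finset.range (2 * n), ((i : ℝ) + 1)⁻¹)
    (hB : B ≤ B' + 2 * d + 6 ∨ B ≤ σ + 4) : B ≤ O + f O + 30 * Real.log (O + 2) := by
  have hn0 : (0 : ℝ) ≤ n := n.cast_nonneg
  have hO : 0 ≤ O := by linarith
  have hfn : f n ≤ f O := hf hn0 hO (by linarith)
  have hfO : 0 ≤ f O := hf0.trans (hf (by simp) hO hO)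
  have hlog2 : Real.log 2 ≤ Real.log (O + 2) := Real.log_le_log (by norm_num) (by linarith)
  have h2 := Real.log_two_gt_d9
  rcases hB with hB | hB
  · have h1 : ∑ i ∈ Finset.range (2 * n), ((i : ℝ) + 1)⁻¹ ≤ 1 + Real.log (2 * n : ℕ) := by
      refine le_trans (le_of_eq ?_) (harmonic_le_one_add_log (2 * n))
      simp [harmonic]
    have h3 : Real.log (2 * n : ℕ) ≤ Real.log 2 + Real.log (O + 2) := by
      rcases Nat.eq_zero_or_pos n with rfl | hn1
      · simp only [mul_zero, Nat.cast_zero, Real.log_zero]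
        linarith
      · rw [← Real.log_mul (by norm_num) (by linarith)]
        have : (1 : ℝ) ≤ n := by exact_mod_cast hn1
        refine Real.log_le_log (by positivity) ?_
        push_cast
        linarith
    linarith
  · linarith

section Packing

variable {K : Type*} [Field K] [LinearOrder K] [IsStrictOrderedRing K]

/-- The interface to both machine models: `K` is the field of the machine, `ι` its embedding into
the reals, where the relaxation is evaluated. That rounded sizes are sizes of input items keeps the
encoding of the rounded instance short. -/
theorem exists_packing {ι : K →+* ℝ} (hι : StrictMono ι) {f : ℝ → ℝ}
    (hf : MonotoneOn f (Set.Ici 0)) (hf0 : 0 ≤ f 0) {m : ℕ} {s : Fin m → K}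
    (hs : ∀ i, s i ∈ Set.Icc 0 1) {k : List (K × K × K)} {d r : List (K × K)}
    (h : prepare (List.ofFn s) = ((k, d), r)) :
    k.length ≤ m ∧ ∃ n : ℕ, (∀ i, (k.get i).1 ∈ Set.Icc 0 1) ∧
      numSizes (fun i => (k.get i).1) ≤ n ∧ (∀ i, 1 / (n : K) ≤ (k.get i).1) ∧
      (∀ i, ∃ j, (k.get i).1 = s j) ∧
      ∀ b : Fin k.length → ℕ, IsPacking (fun i => (k.get i).1) b →
        (numBins b : ℝ) ≤ optF (fun i => ι (k.get i).1) + f n →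
        ∃ a : Fin m → ℕ,
          labelsInOrder (complete k d r (List.ofFn fun i => (b i : K))) =
            List.ofFn (fun i => (a i : K)) ∧ IsPacking s a ∧
          (numBins a : ℝ) ≤ optF (fun i => ι (s i)) + f (optF fun i => ι (s i)) +
            30 * Real.log (optF (fun i => ι (s i)) + 2) := by
  obtain ⟨n, hn1, hn2, hp, hk, hcard, ⟨φ, hφ, hφs⟩, hdr, hd, hr⟩ := prepare_spec hs h
  have hsι : ∀ i, 0 ≤ ι (s i) ∧ ι (s i) ≤ 1 := fun i =>
    ⟨by simpa using hι.monotone (hs i).1, by simpa using hι.monotone (hs i).2⟩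
  have hmem := fun i : Fin k.length => hk _ (k.get_mem i)
  refine ⟨by simpa using Fintype.card_le_of_injective φ hφ, n, fun i => ?_, ?_, fun i => ?_,
    fun i => ?_, fun b hb hbn => ?_⟩
  · exact ⟨(hmem i).1.trans (hmem i).2.1, (hφs i).trans (hs _).2⟩
  · refine (Finset.card_le_card fun x hx => ?_).trans hcard
    obtain ⟨i, -, rfl⟩ := Finset.mem_image.1 hx
    exact List.mem_toFinset.2 (List.mem_map_of_mem (k.get_mem i))
  · have := (hmem i).2.2.1
    rcases Nat.eq_zero_or_pos n with rfl | hn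
    · simp at this
      linarith
    · rw [div_le_iff₀ (by exact_mod_cast hn)]
      linarith
  · obtain ⟨j, hj⟩ := List.mem_ofFn.1 (hmem i).2.2.2
    exact ⟨j, hj.symm⟩
  · obtain ⟨a, ha, hpack, hbound⟩ := complete_spec hn2 hp
      (fun x hx => ⟨(hk x hx).1, (hk x hx).2.1⟩) hdr hr hb
    refine ⟨a, ha, hpack, numBins_bound hf hf0 (n := n) (σ := ι (∑ i, s i))
      (d := ι (d.map Prod.fst).sum) ?_ ?_ (optF_le_of_injective hsι φ hφ
        fun i => hι.monotone (hφs i)) hbn ?_ ?_⟩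
    · simpa using hι.monotone hn1
    · rw [map_sum]
      exact sum_le_optF fun i => (hsι i).2
    · simpa [map_ofNat] using hι.monotone hd
    · refine hbound.imp (fun h => ?_) (fun h => ?_)
      · simpa [map_ofNat] using hι.monotone h
      · simpa [map_ofNat] using hι.monotone h

end Packing

theorem ofFn_get_fst {K β : Type*} (k : List (K × β)) :
    List.ofFn (fun i => (k.get i).1) = k.map Prod.fst := by
  apply List.ext_getElem <;> simp

/-- On the empty instance the relaxation is `0`, so the assumed algorithm itself forces `f 0 ≥ 0`.
-/
theorem zero_le_of_packsWithin {K : Type*} [Field K] [LinearOrder K] {size : K → ℕ} {A : Prog}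
    {s : Fin 0 → K} {s' : Fin 0 → ℝ} {T : ℕ} {x : ℝ}
    (h : PacksWithin size A s T (optF s' + x)) : 0 ≤ x := by
  obtain ⟨a, -, -, h⟩ := h
  rw [optF_fin_zero, zero_add] at h
  exact (Nat.cast_nonneg _).trans h

/-! ### The model with real sizes and unit cost. -/

theorem real_main {f : ℝ → ℝ} (hf : MonotoneOn f (Set.Ici 0))
    (hA : ∃ (A : Prog) (p : Polynomial ℕ), ∀ (m n : ℕ) (s : Fin m → ℝ),
      (∀ i, s i ∈ Set.Icc 0 1) → numSizes s ≤ n → (∀ i, 1 / (n : ℝ) ≤ s i) →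
      PacksWithin unitCost A s (p.eval m) (optF s + f n)) :
    ∃ (B : Prog) (q : Polynomial ℕ), ∀ (m : ℕ) (s : Fin m → ℝ), (∀ i, s i ∈ Set.Icc 0 1) →
      PacksWithin unitCost B s (q.eval m)
        (optF s + f (optF s) + 30 * Real.log (optF s + 2)) := by
  obtain ⟨A, p, hA⟩ := hA
  have hf0 : 0 ≤ f 0 := by
    simpa using zero_le_of_packsWithin
      (hA 0 0 (fun i => i.elim0) (fun i => i.elim0) (by simp [numSizes]) (fun i => i.elim0))
  obtain ⟨P₁, p₁, -, h₁⟩ := polyTime_prepare (K := ℝ)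
  obtain ⟨P₂, p₂, -, h₂⟩ := PolyTime.map (K := ℝ)
    (PolyTime.fst (PolyTime.fst
      (PolyTime.id (α := (List (ℝ × ℝ × ℝ) × List (ℝ × ℝ)) × List (ℝ × ℝ)))))
    (PolyTime.fst PolyTime.id) 1 (fun b => by simp)
  obtain ⟨P₃, p₃, -, h₃⟩ := polyTime_complete (K := ℝ)
  let N₁ : Polynomial ℕ := 2 * .X + 1
  let N₂ : Polynomial ℕ := p₁.comp N₁
  -- `P₂` extracts the rounded sizes for `A`; `.pair .id` retains the prepared data, which `P₃`
  -- needs to complete the packing.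
  refine ⟨.seq P₁ (.seq (.pair .id (.seq P₂ A)) P₃),
    N₂ + p₂.comp N₂ + p + p₃.comp (N₂ + 2 * .X + 2) + 10, fun m s hs => ?_⟩
  obtain ⟨⟨t₁, ht₁, e₁⟩, hz₁⟩ := h₁ (List.ofFn s)
  obtain ⟨⟨⟨k, d⟩, r⟩, hkdr⟩ : ∃ x, prepare (List.ofFn s) = x := ⟨_, rfl⟩
  obtain ⟨hkm, n, c1, c2, c3, -, hfin⟩ :=
    exists_packing (ι := RingHom.id ℝ) strictMono_id hf hf0 hs hkdr
  rw [hkdr] at e₁ hz₁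
  obtain ⟨⟨t₂, ht₂, e₂⟩, -⟩ := h₂ ((k, d), r)
  obtain ⟨b, ⟨tA, htA, eA⟩, hbp, hbn⟩ := hA _ n _ c1 c2 c3
  obtain ⟨a, ha, hap, han⟩ := hfin b hbp hbn
  obtain ⟨⟨t₃, ht₃, e₃⟩, -⟩ := h₃ (((k, d), r), List.ofFn fun i => (b i : ℝ))
  rw [encode_eq_enc, ofFn_get_fst, encode_eq_enc] at eA
  dsimp only at e₂ e₃
  rw [ha] at e₃
  refine ⟨a, ⟨_, ?_, .seq e₁ (.seq (.pair (.id _) (.seq e₂ eA)) e₃)⟩, hap, han⟩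
  rw [esize_list_self, List.length_ofFn] at ht₁ hz₁
  have hz₂ : esize ℝ (((k, d), r), List.ofFn fun i => (b i : ℝ)) ≤
      p₁.eval (2 * m + 1) + 2 * m + 2 := by
    rw [esize_prod, esize_list_self, List.length_ofFn]
    dsimp only
    omega
  have i₂ := polynomial_eval_mono p₂ hz₁
  have i₃ := polynomial_eval_mono p₃ hz₂
  have iA := polynomial_eval_mono p hkm
  simp only [N₁, N₂, Polynomial.eval_add, Polynomial.eval_mul, Polynomial.eval_comp,
    Polynomial.eval_X, Polynomial.eval_one, Polynomial.eval_ofNat] at i₂ i₃ iA ⊢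
  omega

/-! ### The model with rational sizes and bit cost. -/

theorem PolyTime.exists_bitCost {α β : Type*} [Enc ℚ α] [Enc ℚ β] {f : α → β}
    (hf : PolyTime ℚ f) :
    ∃ (P : Prog) (p : Polynomial ℕ), ∀ (D M N : ℕ) (x : α), D ≠ 0 →
      (Enc.enc x).All (BoundedRat D M) → esize ℚ x + M + D.size ≤ N →
      (∃ t ≤ p.eval N, Eval bitCost P (Enc.enc x) (Enc.enc (f x)) t) ∧
        (Enc.enc (f x)).All (BoundedRat D (p.eval N)) ∧ esize ℚ (f x) ≤ p.eval N := by
  obtain ⟨P, p, hP, h⟩ := hf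
  -- The number of steps times the cost of a step: exponents start at `M ≤ N` and grow by at most
  -- one per step, and `D.size ≤ N`.
  refine ⟨P, p * (1 + 3 * (.X + p + 1 + 2 * .X)) + p + .X, fun D M N x hD hx hN => ?_⟩
  obtain ⟨⟨t, ht, e⟩, hs⟩ := h x
  have hpN := polynomial_eval_mono p (show esize ℚ x ≤ N by omega)
  dsimp only at hpN
  obtain ⟨hall, hcost⟩ := e.bitCost_of_unit hD hP M hx
  obtain ⟨u, hu, eu⟩ := hcost (N + p.eval N) (by omega)
  have hu' : u ≤ p.eval N * (1 + 3 * (N + p.eval N + 1 + 2 * N)) :=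
    hu.trans (Nat.mul_le_mul (ht.trans hpN) (by omega))
  simp only [Polynomial.eval_add, Polynomial.eval_mul, Polynomial.eval_X, Polynomial.eval_one,
    Polynomial.eval_ofNat]
  exact ⟨⟨u, by omega, eu⟩, hall.mono fun y hy => hy.mono (by omega), by omega⟩

theorem bitCost_lt_encodingLength {m : ℕ} (s : Fin m → ℚ) (i : Fin m) :
    bitCost (s i) + 1 ≤ encodingLength s :=
  Finset.single_le_sum (f := fun i => bitCost (s i) + 1) (fun _ _ => Nat.zero_le _)
    (Finset.mem_univ i)

theorem le_encodingLength {m : ℕ} (s : Fin m → ℚ) : m ≤ encodingLength s := by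
  simpa [encodingLength] using Finset.card_nsmul_le_sum Finset.univ (fun i => bitCost (s i) + 1) 1 (by simp)

theorem size_prod_den_le {m : ℕ} (s : Fin m → ℚ) :
    (∏ i, (s i).den).size ≤ encodingLength s + 1 := by
  rw [Nat.size_le, Nat.pow_succ]
  have h : ∏ i, (s i).den ≤ ∏ i, 2 ^ (bitCost (s i) + 1) := by
    gcongr with i
    exact (Nat.lt_size_self _).le.trans
      (Nat.pow_le_pow_right (by norm_num) (by rw [bitCost]; omega))
  rw [Finset.prod_pow_eq_pow_sum] at h
  have : 0 < 2 ^ encodingLength s := by positivity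
  change _ ≤ 2 ^ encodingLength s at h
  omega

theorem boundedRat_of_mem_Icc {m : ℕ} {s : Fin m → ℚ} (hs : ∀ i, s i ∈ Set.Icc 0 1) (i : Fin m) :
    BoundedRat (∏ i, (s i).den) 0 (s i) := by
  obtain ⟨c, hc⟩ := Finset.dvd_prod_of_mem (fun i => (s i).den) (Finset.mem_univ i)
  refine ⟨⟨(s i).num * c, ?_⟩, ?_⟩
  · rw [hc]
    push_cast
    rw [← mul_assoc, Rat.mul_den_eq_num]
  · rw [abs_of_nonneg (hs i).1, pow_zero]
    exact (hs i).2

theorem rat_main {f : ℝ → ℝ} (hf : MonotoneOn f (Set.Ici 0))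
    (hA : ∃ (A : Prog) (p : Polynomial ℕ), ∀ (m n : ℕ) (s : Fin m → ℚ),
      (∀ i, s i ∈ Set.Icc 0 1) → numSizes s ≤ n → (∀ i, 1 / (n : ℚ) ≤ s i) →
      PacksWithin bitCost A s (p.eval (encodingLength s)) (optF (fun i => (s i : ℝ)) + f n)) :
    ∃ (B : Prog) (q : Polynomial ℕ), ∀ (m : ℕ) (s : Fin m → ℚ), (∀ i, s i ∈ Set.Icc 0 1) →
      PacksWithin bitCost B s (q.eval (encodingLength s))
        (optF (fun i => (s i : ℝ)) + f (optF (fun i => (s i : ℝ))) +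
          30 * Real.log (optF (fun i => (s i : ℝ)) + 2)) := by
  obtain ⟨A, p, hA⟩ := hA
  have hf0 : 0 ≤ f 0 := by
    simpa using zero_le_of_packsWithin
      (hA 0 0 (fun i => i.elim0) (fun i => i.elim0) (by simp [numSizes]) (fun i => i.elim0))
  obtain ⟨P₁, p₁, h₁⟩ := (polyTime_prepare (K := ℚ)).exists_bitCost
  obtain ⟨P₂, p₂, h₂⟩ := (PolyTime.map (K := ℚ)
    (PolyTime.fst (PolyTime.fst
      (PolyTime.id (α := (List (ℚ × ℚ × ℚ) × List (ℚ × ℚ)) × List (ℚ × ℚ)))))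
    (PolyTime.fst PolyTime.id) 1 (fun b => by simp)).exists_bitCost
  obtain ⟨P₃, p₃, h₃⟩ := (polyTime_complete (K := ℚ)).exists_bitCost
  let N₁ : Polynomial ℕ := 3 * .X + 2
  let N₂ : Polynomial ℕ := 2 * p₁.comp N₁ + .X + 1
  -- With `L` the encoding length, the rounded instance has at most `L` items, each an input size of
  -- length at most `L`.
  let NA : Polynomial ℕ := p.comp (.X * .X)
  let N₃ : Polynomial ℕ := N₂ + 4 * .X + 4 + NA
  refine ⟨.seq P₁ (.seq (.pair .id (.seq P₂ A)) P₃),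
    p₁.comp N₁ + p₂.comp N₂ + NA + p₃.comp N₃ + 10, fun m s hs => ?_⟩
  have hm := le_encodingLength s
  have hcost := bitCost_lt_encodingLength s
  have hsize := size_prod_den_le s
  have hD : ∏ i, (s i).den ≠ 0 := Finset.prod_ne_zero_iff.2 fun i _ => (s i).den_ne_zero
  have hall : (Enc.enc (List.ofFn s) : Datum ℚ).All (BoundedRat (∏ i, (s i).den) 0) :=
    all_enc_list fun x hx => by
      obtain ⟨i, rfl⟩ := List.mem_ofFn.1 hx
      exact boundedRat_of_mem_Icc hs i
  generalize ∏ i, (s i).den = D at *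
  obtain ⟨⟨t₁, ht₁, e₁⟩, a₁, z₁⟩ := h₁ D 0 (N₁.eval (encodingLength s)) _ hD hall (by
    rw [esize_list_self, List.length_ofFn]
    simp only [N₁, Polynomial.eval_add, Polynomial.eval_mul, Polynomial.eval_X,
      Polynomial.eval_ofNat]
    omega)
  obtain ⟨⟨⟨k, d⟩, r⟩, hkdr⟩ : ∃ x, prepare (List.ofFn s) = x := ⟨_, rfl⟩
  obtain ⟨hkm, n, c1, c2, c3, c4, hfin⟩ :=
    exists_packing (ι := Rat.castHom ℝ) Rat.cast_strictMono hf hf0 hs hkdr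
  rw [hkdr] at e₁ a₁ z₁
  obtain ⟨⟨t₂, ht₂, e₂⟩, -, -⟩ := h₂ D _ (N₂.eval (encodingLength s)) _ hD a₁ (by
    simp only [N₂, Polynomial.eval_add, Polynomial.eval_mul, Polynomial.eval_comp,
      Polynomial.eval_X, Polynomial.eval_ofNat, Polynomial.eval_one] at z₁ ⊢
    omega)
  obtain ⟨b, ⟨tA, htA, eA⟩, hbp, hbn⟩ := hA _ n _ c1 c2 c3
  obtain ⟨a, ha, hap, han⟩ := hfin b hbp hbn
  have hkcost : ∀ i, bitCost (k.get i).1 + 1 ≤ encodingLength s := fun i => by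
    obtain ⟨j, hj⟩ := c4 i
    exact hj ▸ hcost j
  have htA' : tA ≤ NA.eval (encodingLength s) := by
    refine htA.trans ?_
    simp only [NA, Polynomial.eval_comp, Polynomial.eval_mul, Polynomial.eval_X]
    refine polynomial_eval_mono p ?_
    have h5 : encodingLength (fun i => (k.get i).1) ≤ k.length * encodingLength s := by
      simpa [encodingLength] using Finset.sum_le_card_nsmul Finset.univ
        (fun i => bitCost (k.get i).1 + 1) (encodingLength s) (fun i _ => hkcost i)
    exact h5.trans (Nat.mul_le_mul_right _ (hkm.trans hm))
  rw [encode_eq_enc, encode_eq_enc] at eA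
  -- `A` may multiply and divide, so the lengths of its labels are bounded by its running time
  -- instead; being natural numbers, the labels fit any common denominator `D`.
  have hb : ∀ i, BoundedRat D (encodingLength s + 2 + tA) (b i) := by
    have h6 := mem_of_all_enc_list (eA.all_bitCost_le (encodingLength s + 2) (by omega)
      (all_enc_list fun x hx => by
        obtain ⟨i, rfl⟩ := List.mem_ofFn.1 hx
        have := hkcost i
        omega))
    intro i
    have h7 := BoundedRat.of_bitCost (h6 _ (List.mem_ofFn.2 ⟨i, rfl⟩))
    rw [Nat.abs_cast] at h7
    exact BoundedRat.natCast (by exact_mod_cast h7)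
  have a₃ : (Enc.enc (((k, d), r), List.ofFn fun i => (b i : ℚ)) : Datum ℚ).All
      (BoundedRat D (p₁.eval (N₁.eval (encodingLength s)) + (encodingLength s + 2 + tA))) :=
    ⟨a₁.mono fun y hy => hy.mono (by omega), all_enc_list fun x hx => by
      obtain ⟨i, rfl⟩ := List.mem_ofFn.1 hx
      exact (hb i).mono (by omega)⟩
  obtain ⟨⟨t₃, ht₃, e₃⟩, -, -⟩ := h₃ D _ (N₃.eval (encodingLength s)) _ hD a₃ (by
    rw [esize_prod, esize_list_self, List.length_ofFn]
    simp only [N₃, N₂, Polynomial.eval_add, Polynomial.eval_mul, Polynomial.eval_comp,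
      Polynomial.eval_X, Polynomial.eval_ofNat, Polynomial.eval_one] at z₁ ⊢
    omega)
  rw [ofFn_get_fst] at eA
  dsimp only at e₂ e₃
  rw [ha] at e₃
  refine ⟨a, ⟨_, ?_, .seq e₁ (.seq (.pair (.id _) (.seq e₂ eA)) e₃)⟩, hap, han⟩
  simp only [Polynomial.eval_add, Polynomial.eval_comp, Polynomial.eval_ofNat] at *
  omega

end BinPacking

theorem mainTheorem9 :
    ∃ C : ℝ, ∀ f : ℝ → ℝ, MonotoneOn f (Set.Ici 0) →
      -- real sizes, unit cost, time polynomial in the number `m` of items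
      ((∃ (A : BinPacking.Prog) (p : Polynomial ℕ), ∀ (m n : ℕ) (s : Fin m → ℝ),
          (∀ i, s i ∈ Set.Icc 0 1) → BinPacking.numSizes s ≤ n → (∀ i, 1 / (n : ℝ) ≤ s i) →
          BinPacking.PacksWithin BinPacking.unitCost A s (p.eval m)
            (BinPacking.optF s + f n)) →
        ∃ (B : BinPacking.Prog) (q : Polynomial ℕ), ∀ (m : ℕ) (s : Fin m → ℝ),
          (∀ i, s i ∈ Set.Icc 0 1) →
          BinPacking.PacksWithin BinPacking.unitCost B s (q.eval m)
            (BinPacking.optF s + f (BinPacking.optF s)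
              + C * Real.log (BinPacking.optF s + 2))) ∧
      -- rational sizes, bit cost, time polynomial in the binary encoding length
      ((∃ (A : BinPacking.Prog) (p : Polynomial ℕ), ∀ (m n : ℕ) (s : Fin m → ℚ),
          (∀ i, s i ∈ Set.Icc 0 1) → BinPacking.numSizes s ≤ n → (∀ i, 1 / (n : ℚ) ≤ s i) →
          BinPacking.PacksWithin BinPacking.bitCost A s (p.eval (BinPacking.encodingLength s))
            (BinPacking.optF (fun i => (s i : ℝ)) + f n)) →
        ∃ (B : BinPacking.Prog) (q : Polynomial ℕ), ∀ (m : ℕ) (s : Fin m → ℚ),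
          (∀ i, s i ∈ Set.Icc 0 1) →
          BinPacking.PacksWithin BinPacking.bitCost B s (q.eval (BinPacking.encodingLength s))
            (BinPacking.optF (fun i => (s i : ℝ)) + f (BinPacking.optF (fun i => (s i : ℝ)))
              + C * Real.log (BinPacking.optF (fun i => (s i : ℝ)) + 2))) := by
  exact ⟨30, fun f hf => ⟨BinPacking.real_main hf, BinPacking.rat_main hf⟩⟩
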